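/- **Theorem 3.** Let $G=(V,E)$ be a finite simple undirected graph with maximum degree $\Delta$, let $0<\varepsilon\le 1$, let $I:=2\lceil 1000(\ln 1500+\ln(2/\varepsilon))\rceil$ and $R:=\lfloor 104000\,(\ln\Delta+\ln(2/\varepsilon))\rfloor$ (with $\ln\Delta$ read as $0$ if $\Delta=0$). Consider the following algorithm in the beep model, where in each slot a node either beeps or listens, and a listening node hears a beep iff at least one of its neighbors beeps in that slot. All nodes start active, with desire-level $p_0(u)=1/2$. The algorithm proceeds in emulated rounds $t=0,1,2,\dots$, each of which consists of two intervals of $I$ slots and one final slot: * In each slot of the first interval, every active node $u$ beeps with probability $p_t(u)$ and otherwise listens. Let $c_t(u)$ be the number of slots of this interval in which $u$ listens, and $b_t(u)$ the number of slots of it in which $u$ hears a beep. If $c_t(u)>I/3$, then $u$ sets $p_{t+1}(u)=p_t(u)/2$ if $b_t(u)/c_t(u)>1/5$, and $p_{t+1}(u)=\min\{2p_t(u),1/2\}$ otherwise; if $c_t(u)\le I/3$, then $u$ picks one of these two updates by a fair coin toss. * Before the second interval, every active node $u$ is marked with probability $p_t(u)$. A marked node chooses uniformly at random a set of $I/2$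 of the $I$ slots, beeps in these slots and listens in the others; all other nodes are silent. A marked node that hears no beep in this interval joins $M$ (it outputs IN). * In the final slot, the nodes that have just joined $M$ beep. They, and the nodes that hear a beep in this slot (these output OUT), are removed: they are no longer active and never beep again. All coin tosses are independent. A decision (output) of $v$ is locally correct if it is never revised and, in case it is IN, no neighbor of $v$ is in $M$ at that moment or later, and, in case it is OUT, some neighbor of $v$ is in $M$ at that moment. Then, for each node $v$, the probability that $v$ makes a locally correct decision within the first $R$ emulated rounds is at least $1-\varepsilon$. Furthermore, this holds even if the outcomes of the coin tosses of the nodes outside $N_2^+(v)$, the set of nodes at hop-distance at most $2$ from $v$ (including $v$), are determined adversarially, where the adversary may choose them in each round depending on all coin tosses of the earlier rounds and on the coin tosses of $N_2^+(v)$ in the current round. -/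

import Mathlib

open scoped NNReal ENNReal

noncomputable section

namespace BeepMIS

/-! ### Parameters -/

/-- The number `I` of slots of an interval: `2000 (ln 1500 + ln (2/ε))`, rounded up to an even
integer, so that half of the slots of an interval can be selected. -/
def intervalLength (ε : ℝ) : ℕ := 2 * ⌈1000 * (Real.log 1500 + Real.log (2 / ε))⌉₊

/-- The number `R = γ (log Δ + log (2/ε))` of emulated rounds, with `γ = 104000`. The logarithm is
the natural one (which gives the smallest `R`), and `log 0 = 0` covers graphs without edges. -/
def rounds (Δ : ℕ) (ε : ℝ) : ℕ := ⌊104000 * (Real.log Δ + Real.log (2 / ε))⌋₊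

/-! ### Coin tosses -/

/-- The outcomes of the coin tosses of one node in one emulated round: whether it beeps in each of
the slots of the first interval, the choice it makes if it did not listen often enough, whether it
is marked, and the half of the slots of the second interval in which it beeps if it is marked. -/
structure NodeCoins (I : ℕ) where
  beep : Fin I → Bool
  guessHigh : Bool
  marked : Bool
  slots : {S : Finset (Fin I) // S.card = I / 2}

instance (I : ℕ) : Fintype (NodeCoins I) :=
  Fintype.ofInjective
    (fun c : NodeCoins I => (c.beep, c.guessHigh, c.marked, c.slots))
    (by rintro ⟨a, b, c, d⟩ ⟨a', b', c', d'⟩ h; simp_all)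

instance (I : ℕ) : Nonempty {S : Finset (Fin I) // S.card = I / 2} := by
  obtain ⟨S, -, hS⟩ := Finset.exists_subset_card_eq
    (s := (Finset.univ : Finset (Fin I))) (n := I / 2) (by simpa using Nat.div_le_self I 2)
  exact ⟨⟨S, hS⟩⟩

/-- A coin that shows `true` with probability `p`. -/
def coinLaw (p : ℝ≥0) (hp : p ≤ 1) : PMF Bool :=
  PMF.ofFintype (fun b => if b then (p : ℝ≥0∞) else ((1 - p : ℝ≥0) : ℝ≥0∞)) (by
    rw [Fintype.sum_bool]
    simp only [if_true, Bool.false_eq_true, if_false]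
    rw [← ENNReal.coe_add, add_tsub_cancel_of_le hp, ENNReal.coe_one])

/-- The law of a family of independent random variables with laws `μ a`. -/
def indepLaw {A : Type*} {B : Type*} [Fintype A] [DecidableEq A] [Fintype B]
    (μ : A → PMF B) : PMF (A → B) :=
  PMF.ofFintype (fun x => ∏ a, μ a (x a)) (by
    have h : ∏ a : A, ∑ b : B, μ a b = ∑ x : A → B, ∏ a, μ a (x a) :=
      Fintype.prod_sum (fun a b => μ a b)
    rw [← h]
    refine Finset.prod_eq_one fun a _ => ?_
    exact (tsum_fintype (μ a)).symm.trans (μ a).tsum_coe)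

/-- The law of the coin tosses, in one emulated round, of a node whose desire-level is `p`. -/
def nodeLaw (I : ℕ) (p : ℝ≥0) (hp : p ≤ 1) : PMF (NodeCoins I) :=
  (indepLaw fun _ : Fin I => coinLaw p hp).bind fun b =>
  (coinLaw (1 / 2) (by simp)).bind fun g =>
  (coinLaw p hp).bind fun m =>
  (PMF.uniformOfFintype {S : Finset (Fin I) // S.card = I / 2}).bind fun S =>
  PMF.pure ⟨b, g, m, S⟩

section Algorithm

variable {V : Type*} (G : SimpleGraph V) (I : ℕ)

/-! ### The beep model and the algorithm -/

/-- A single slot of the beep model: when exactly the nodes of `B` beep, the node `v` hears a beep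
iff it listens (it does not beep itself) and at least one of its neighbors beeps. -/
def Hears (B : Set V) (v : V) : Prop := v ∉ B ∧ ∃ u, G.Adj v u ∧ u ∈ B

/-- A node is still participating, or has joined `M` (output IN), or was removed because a neighbor
joined `M` (output OUT). -/
inductive Status
  | active
  | isIn
  | isOut

/-- The state of the network between two emulated rounds: the status and the desire-level `p_t(u)`
of every node. -/
structure Config (V : Type*) where
  status : V → Status
  desire : V → ℝ≥0
  desire_le : ∀ u, desire u ≤ 1 / 2

def initial (V : Type*) : Config V where
  status := fun _ => Status.active
  desire := fun _ => 1 / 2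
  desire_le := fun _ => le_refl _

variable {G I}

/-- The nodes that beep in slot `i` of the first interval. -/
def firstBeepers (c : Config V) (x : V → NodeCoins I) (i : Fin I) : Set V :=
  {u | c.status u = Status.active ∧ (x u).beep i = true}

open Classical in
/-- The counter `c_t(v)`: the number of slots of the first interval in which `v` listens. -/
def listenCount (c : Config V) (x : V → NodeCoins I) (v : V) : ℕ :=
  (Finset.univ.filter fun i : Fin I => v ∉ firstBeepers c x i).card

variable (G) in
open Classical in
/-- The counter `b_t(v)`: the number of slots of the first interval in which `v` hears a beep. -/
def beepCount (c : Config V) (x : V → NodeCoins I) (v : V) : ℕ :=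
  (Finset.univ.filter fun i : Fin I => Hears G (firstBeepers c x i) v).card

variable (G) in
/-- The decision of `v` whether `b_t(v) / c_t(v) > 1/5`. It is a fair coin toss if `v` listened in
at most a third of the slots. -/
def LikelyHigh (c : Config V) (x : V → NodeCoins I) (v : V) : Prop :=
  ((I : ℝ) / 3 < listenCount c x v ∧ (1 : ℝ) / 5 < (beepCount G c x v : ℝ) / listenCount c x v) ∨
  ((listenCount c x v : ℝ) ≤ I / 3 ∧ (x v).guessHigh = true)

/-- The nodes that beep in slot `i` of the second interval. -/
def secondBeepers (c : Config V) (x : V → NodeCoins I) (i : Fin I) : Set V :=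
  {u | c.status u = Status.active ∧ (x u).marked = true ∧ i ∈ (x u).slots.1}

variable (G) in
/-- The nodes that join `M`: they are marked and hear no beep while they listen during the second
interval. These are the nodes that beep in the final slot. -/
def joining (c : Config V) (x : V → NodeCoins I) : Set V :=
  {v | c.status v = Status.active ∧ (x v).marked = true ∧
    ∀ i : Fin I, ¬ Hears G (secondBeepers c x i) v}

variable (G) in
open Classical in
/-- One emulated round: the first interval (update of the desire-levels), the second interval
(decision who joins `M`), and the final slot, in which the nodes that join `M` beep and the nodes
that hear them are removed. -/
def step (c : Config V) (x : V → NodeCoins I) : Config V where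
  status := fun v =>
    if c.status v = Status.active then
      if v ∈ joining G c x then Status.isIn
      else if Hears G (joining G c x) v then Status.isOut
      else Status.active
    else c.status v
  desire := fun v =>
    if c.status v = Status.active then
      if LikelyHigh G c x v then c.desire v / 2 else min (2 * c.desire v) (1 / 2)
    else c.desire v
  desire_le := fun v => by
    split_ifs
    · exact (half_le_self zero_le).trans (c.desire_le v)
    · exact min_le_right _ _
    · exact c.desire_le v

/-- The state after the emulated rounds with the coin tosses `h`, the latest round first. -/
def config (G : SimpleGraph V) : List (V → NodeCoins I) → Config V
  | [] => initial V
  | x :: h => step G (config G h) x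

/-- The state after the first `t` of the rounds in `h` (for `t ≤ h.length`). -/
def configAt (G : SimpleGraph V) (h : List (V → NodeCoins I)) (t : ℕ) : Config V :=
  config G (h.drop (h.length - t))

/-- In the execution with the coin tosses `h`, the node `v` makes a locally correct decision within
the first `R` emulated rounds: in one of these rounds it outputs IN or OUT and never revises this.
If it outputs IN, then none of its neighbors is IN at that moment or later; if it outputs OUT, then
at that moment some neighbor is IN. -/
def DecidesCorrectly (G : SimpleGraph V) (R : ℕ) (v : V) (h : List (V → NodeCoins I)) : Prop :=
  ∃ t < R, t < h.length ∧ (configAt G h t).status v = Status.active ∧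
    ((∀ s, t < s → s ≤ h.length → (configAt G h s).status v = Status.isIn ∧
        ∀ u, G.Adj v u → (configAt G h s).status u ≠ Status.isIn) ∨
     ((∀ s, t < s → s ≤ h.length → (configAt G h s).status v = Status.isOut) ∧
        ∃ u, G.Adj v u ∧ (configAt G h (t + 1)).status u = Status.isIn))

/-! ### Random executions -/

theorem desire_le_one (c : Config V) (u : V) : c.desire u ≤ 1 :=
  (c.desire_le u).trans (by simp)

open Classical in
/-- The coin tosses of one round, after the history `h`, of the nodes of `S`: independent, with the
probabilities prescribed by the algorithm. -/
def coinsOn [Fintype V] (G : SimpleGraph V) (S : Set V) (h : List (V → NodeCoins I)) :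
    PMF (S → NodeCoins I) :=
  indepLaw fun u : S => nodeLaw I ((config G h).desire u) (desire_le_one _ _)

open Classical in
/-- A round in which all nodes toss their coins. -/
def fairRound [Fintype V] (G : SimpleGraph V) (h : List (V → NodeCoins I)) : PMF (V → NodeCoins I) :=
  indepLaw fun u : V => nodeLaw I ((config G h).desire u) (desire_le_one _ _)

/-- An adversary for the nodes outside `S`: it fixes the outcomes of their coin tosses of a round
depending on all coin tosses of all earlier rounds and on the coin tosses of the nodes of `S` in the
current round. -/
abbrev Adversary (S : Set V) (I : ℕ) : Type _ :=
  List (V → NodeCoins I) → (S → NodeCoins I) → ((Sᶜ : Set V) → NodeCoins I)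

open Classical in
/-- A round in which the nodes of `S` toss their coins, and the outcomes of the coin tosses of all
other nodes are determined by the adversary. -/
def adversarialRound [Fintype V] (G : SimpleGraph V) {S : Set V} (adv : Adversary S I)
    (h : List (V → NodeCoins I)) : PMF (V → NodeCoins I) :=
  (coinsOn G S h).map fun x u => if hu : u ∈ S then x ⟨u, hu⟩ else adv h x ⟨u, hu⟩

/-- The law of the coin tosses of the first `T` rounds, the latest round first, if `round h` is the
law of the coin tosses of a round that follows the history `h`. -/
def execution (round : List (V → NodeCoins I) → PMF (V → NodeCoins I)) :
    ℕ → PMF (List (V → NodeCoins I))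
  | 0 => PMF.pure []
  | T + 1 => (execution round T).bind fun h => (round h).map fun x => x :: h

end Algorithm

/-- `N₂⁺(v)`: the nodes at hop-distance at most two from `v`, including `v`. -/
def twoHop {V : Type*} (G : SimpleGraph V) (v : V) : Set V := {u | G.edist u v ≤ 2}

end BeepMIS

end

/-!
The proof follows an active node `v` by its desire-level `p` and its load `d`, the sum of the
desire-levels of its active neighbors.

*Estimates.* By a Chernoff bound, a node with load at least `1/2` halves its desire-level, and one
with load at most `4/25` doubles it (up to `1/2`), except with probability `1/1000`
(`prob_not_likelyHigh_le`, `prob_likelyHigh_le`). Loads in between may be misjudged.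

*Removal.* A marked node without marked neighbors joins `M`. So `v` is removed with probability at
least `p (1 - d)` (`prob_stays_le_of_self`). If `r` is the sum of the desire-levels of its light
neighbors, those with loads less than `1/2`, a second moment argument shows that it is removed with
probability at least `r / (4 (1 + r))` (`prob_stays_le_of_light`).

*Potential.* Consider `Φ = max(d, 3/25)^α * p^(-β)`, up to a constant factor, for small `α` and `β`.
In a favorable round, where the light neighbors contribute a sixth of a load `d ≥ 3/50`, or where
`d ≤ 4/25` and `p > 1/4`, the node is removed with constant probability. In any other round the heavy
neighbors, which halve their desire-levels, dominate the load unless it is tiny. Then `d` shrinks if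
`d > 4/25`, while `p` doubles and `d` stays small if `d ≤ 4/25`. In each case the expectation of `Φ`
decreases by the factor `1 - 1/10000`, if it counts as zero after the removal of `v`
(`expect_stays_mul_potential_le`). As `Φ ≥ 1` while `v` is active and `Φ ≤ 5 max(Δ, 1)` in the
beginning, `v` is active after `R` rounds with probability at most `ε / 2`
(`potential_initial_mul_le`).

*Conflicts.* The decision of `v` can only be wrong if `v` joins `M` together with a neighbor. Then both
have chosen the same slots of the second interval, which has probability at most `p / C` in a round,
where `C` is the number of choices of slots (`prob_conflict_le`). The expected sum of `p` over all
rounds is bounded: small loads with large `p` lead to removal, and large loads to a halving of `p`.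
This gives a total conflict probability of at most `(8 + 3 p) / C` (`expect_conflict_add_le`),
although the number of rounds is not bounded in terms of `ε`.

*Adversary.* All these bounds concern quantities that are determined by the coin tosses of the nodes
in `N₂⁺(v)` (`dependsOn_twoHop`), and hold after each history. So they apply to fair rounds and to
adversarial rounds alike (`FairOn`).
-/

open scoped NNReal ENNReal

noncomputable section

namespace BeepMIS

/-! ### Expectations over finite probability spaces -/

theorem tsum_bind_mul {α β : Type*} (μ : PMF α) (κ : α → PMF β) (g : β → ℝ≥0∞) :
    ∑' b, μ.bind κ b * g b = ∑' a, μ a * ∑' b, κ a b * g b := by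
  simp only [PMF.bind_apply, ← ENNReal.tsum_mul_right, ← ENNReal.tsum_mul_left, mul_assoc]
  exact ENNReal.tsum_comm

theorem tsum_pure_mul {α : Type*} (a : α) (g : α → ℝ≥0∞) : ∑' b, PMF.pure a b * g b = g a := by
  rw [tsum_eq_single a fun b hb => by simp [PMF.pure_apply, hb]]
  simp

section Expectation

variable {α β : Type*} [Fintype α] [Fintype β]

/-- The expectation of a real random variable on a finite probability space. -/
def expect (μ : PMF α) (f : α → ℝ) : ℝ := ∑ a, (μ a).toReal * f a

theorem sum_toReal_eq_one (μ : PMF α) : ∑ a, (μ a).toReal = 1 := by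
  rw [← ENNReal.toReal_sum fun a _ => μ.apply_ne_top a, ← tsum_fintype (L := .unconditional _),
    μ.tsum_coe, ENNReal.toReal_one]

theorem expect_mono (μ : PMF α) {f g : α → ℝ} (h : ∀ a, f a ≤ g a) :
    expect μ f ≤ expect μ g :=
  Finset.sum_le_sum fun a _ => mul_le_mul_of_nonneg_left (h a) ENNReal.toReal_nonneg

theorem expect_nonneg (μ : PMF α) {f : α → ℝ} (h : ∀ a, 0 ≤ f a) : 0 ≤ expect μ f :=
  Finset.sum_nonneg fun a _ => mul_nonneg ENNReal.toReal_nonneg (h a)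

@[simp]
theorem expect_const (μ : PMF α) (r : ℝ) : expect μ (fun _ => r) = r := by
  simp [expect, ← Finset.sum_mul, sum_toReal_eq_one]

theorem expect_add (μ : PMF α) (f g : α → ℝ) :
    expect μ (fun a => f a + g a) = expect μ f + expect μ g := by
  simp [expect, mul_add, Finset.sum_add_distrib]

theorem expect_sub (μ : PMF α) (f g : α → ℝ) :
    expect μ (fun a => f a - g a) = expect μ f - expect μ g := by
  simp [expect, mul_sub, Finset.sum_sub_distrib]

theorem expect_const_mul (μ : PMF α) (r : ℝ) (f : α → ℝ) :
    expect μ (fun a => r * f a) = r * expect μ f := by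
  simp only [expect, Finset.mul_sum]
  exact Finset.sum_congr rfl fun a _ => by ring

theorem expect_sum {ι : Type*} (μ : PMF α) (s : Finset ι) (f : ι → α → ℝ) :
    expect μ (fun a => ∑ i ∈ s, f i a) = ∑ i ∈ s, expect μ (f i) := by
  simp only [expect, Finset.mul_sum]
  exact Finset.sum_comm

theorem expect_comm (μ : PMF α) (ν : PMF β) (f : α → β → ℝ) :
    expect μ (fun a => expect ν fun b => f a b) = expect ν fun b => expect μ fun a => f a b := by
  simp only [expect, Finset.mul_sum]
  rw [Finset.sum_comm]
  exact Finset.sum_congr rfl fun a _ => Finset.sum_congr rfl fun b _ => by ring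

theorem expect_bind (μ : PMF α) (κ : α → PMF β) (f : β → ℝ) :
    expect (μ.bind κ) f = expect μ fun a => expect (κ a) f := by
  simp only [expect, PMF.bind_apply, tsum_fintype, Finset.mul_sum]
  rw [Finset.sum_comm]
  refine Finset.sum_congr rfl fun b _ => ?_
  rw [ENNReal.toReal_sum fun a _ =>
    ENNReal.mul_ne_top (μ.apply_ne_top a) ((κ a).apply_ne_top b), Finset.sum_mul]
  exact Finset.sum_congr rfl fun a _ => by rw [ENNReal.toReal_mul]; ring

theorem expect_pure (a : α) (f : α → ℝ) : expect (PMF.pure a) f = f a := by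
  classical
  rw [expect, Finset.sum_eq_single a]
  · simp
  · intro b _ hb
    simp [PMF.pure_apply, hb]
  · simp

theorem expect_map (μ : PMF α) (φ : α → β) (f : β → ℝ) :
    expect (μ.map φ) f = expect μ fun a => f (φ a) := by
  simp only [PMF.map, expect_bind, Function.comp_apply, expect_pure]

theorem expect_coinLaw (p : ℝ≥0) (hp : p ≤ 1) (f : Bool → ℝ) :
    expect (coinLaw p hp) f = p * f true + (1 - p) * f false := by
  have h : (1 - (p : ℝ≥0∞)).toReal = 1 - (p : ℝ) := by
    rw [ENNReal.toReal_sub_of_le (by exact_mod_cast hp) ENNReal.one_ne_top]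
    simp
  simp [expect, coinLaw, PMF.ofFintype_apply, h]

theorem tsum_mul_ofReal (μ : PMF α) {f : α → ℝ} (hf : ∀ a, 0 ≤ f a) :
    ∑' a, μ a * ENNReal.ofReal (f a) = ENNReal.ofReal (expect μ f) := by
  rw [tsum_fintype, expect, ENNReal.ofReal_sum_of_nonneg fun a _ =>
    mul_nonneg ENNReal.toReal_nonneg (hf a)]
  refine Finset.sum_congr rfl fun a _ => ?_
  rw [ENNReal.ofReal_mul ENNReal.toReal_nonneg, ENNReal.ofReal_toReal (μ.apply_ne_top a)]

end Expectation

/-! ### Product laws -/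

section Product

variable {A B C : Type*} [Fintype A] [DecidableEq A] [Fintype B] [Fintype C]

theorem indepLaw_apply_toReal (μ : A → PMF B) (x : A → B) :
    (indepLaw μ x).toReal = ∏ a, (μ a (x a)).toReal := by
  rw [indepLaw, PMF.ofFintype_apply, ENNReal.toReal_prod]

theorem expect_indepLaw_prod (μ : A → PMF B) (g : A → B → ℝ) :
    expect (indepLaw μ) (fun x => ∏ a, g a (x a)) = ∏ a, expect (μ a) (g a) := by
  simp only [expect, indepLaw_apply_toReal, ← Finset.prod_mul_distrib]
  exact (Fintype.prod_sum fun a b => (μ a b).toReal * g a b).symm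

theorem expect_indepLaw_eval (μ : A → PMF B) (a : A) (g : B → ℝ) :
    expect (indepLaw μ) (fun x => g (x a)) = expect (μ a) g := by
  have h := expect_indepLaw_prod μ fun u b => if u = a then g b else 1
  rw [Finset.prod_eq_single a (fun u _ hu => by simp [hu]) (by simp)] at h
  simp only [if_true] at h
  rw [← h]
  congr 1
  funext x
  rw [Finset.prod_eq_single a (fun u _ hu => by simp [hu]) (by simp), if_pos rfl]

theorem expect_indepLaw_eval_mul_eval (μ : A → PMF B) {a a' : A} (h : a ≠ a') (g g' : B → ℝ) :
    expect (indepLaw μ) (fun x => g (x a) * g' (x a')) = expect (μ a) g * expect (μ a') g' := by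
  have key := expect_indepLaw_prod μ fun u b => if u = a then g b else if u = a' then g' b else 1
  rw [Fintype.prod_eq_mul a a' h (fun u hu => by simp [hu.1, hu.2])] at key
  simp only [if_true, h.symm, if_false] at key
  rw [← key]
  congr 1
  funext x
  rw [Fintype.prod_eq_mul a a' h (fun u hu => by simp [hu.1, hu.2])]
  simp [h.symm]

/-- The images of independent random variables are independent. -/
theorem expect_indepLaw_comp (μ : A → PMF B) (φ : B → C) (g : (A → C) → ℝ) :
    expect (indepLaw μ) (fun x => g fun a => φ (x a)) =
      expect (indepLaw fun a => (μ a).map φ) g := by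
  classical
  have hmap : ∀ (a : A) (y : C), ((μ a).map φ y).toReal =
      ∑ b, (μ a b).toReal * if y = φ b then 1 else 0 := by
    intro a y
    rw [PMF.map_apply, tsum_fintype, ENNReal.toReal_sum]
    · refine Finset.sum_congr rfl fun b _ => ?_
      split_ifs <;> simp
    · intro b _
      split_ifs
      · exact (μ a).apply_ne_top b
      · exact ENNReal.zero_ne_top
  simp only [expect, indepLaw_apply_toReal, hmap, Fintype.prod_sum, Finset.sum_mul,
    Finset.prod_mul_distrib]
  rw [Finset.sum_comm]
  refine Finset.sum_congr rfl fun x _ => ?_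
  rw [Finset.sum_eq_single fun a => φ (x a)]
  · simp
  · intro y _ hy
    obtain ⟨a, ha⟩ := Function.ne_iff.1 hy
    rw [Finset.prod_eq_zero (f := fun a => if y a = φ (x a) then (1 : ℝ) else 0)
      (Finset.mem_univ a) (if_neg ha), mul_zero, zero_mul]
  · simp

/-- Exchanging the two indices of an independent array. -/
theorem expect_indepLaw_array {J : Type*} [Fintype J] [DecidableEq J] (κ : A → PMF B)
    (F : (A → B) → ℝ) :
    expect (indepLaw fun a => indepLaw fun _ : J => κ a) (fun b => ∏ j, F fun a => b a j) =
      expect (indepLaw κ) F ^ Fintype.card J := by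
  have h := expect_indepLaw_prod (fun _ : J => indepLaw κ) fun _ => F
  rw [Finset.prod_const, Finset.card_univ] at h
  rw [← h]
  simp only [expect, indepLaw_apply_toReal]
  refine Fintype.sum_equiv (Equiv.piComm fun _ _ => B) _ _ fun b => ?_
  rw [Finset.prod_comm]
  rfl

open Classical in
/-- Splitting an independent family into the members in `S` and the others. -/
theorem expect_indepLaw_split (μ : A → PMF B) (S : Set A) (f : (A → B) → ℝ) :
    expect (indepLaw μ) f =
      expect (indepLaw fun a : S => μ a) fun y =>
        expect (indepLaw fun a : (Sᶜ : Set A) => μ a) fun z =>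
          f fun a => if h : a ∈ S then y ⟨a, h⟩ else z ⟨a, h⟩ := by
  simp only [expect, indepLaw_apply_toReal, Finset.mul_sum]
  rw [← Fintype.sum_prod_type']
  refine Fintype.sum_equiv (Equiv.piEquivPiSubtypeProd (· ∈ S) fun _ => B) _ _ fun x => ?_
  rw [← Fintype.prod_subtype_mul_prod_subtype (· ∈ S), mul_assoc]
  congr 3
  funext a
  by_cases h : a ∈ S <;> simp [Equiv.piEquivPiSubtypeProd, h]

open Classical in
theorem expect_indepLaw_of_dependsOn (μ : A → PMF B) (S : Set A) {f : (A → B) → ℝ}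
    (hf : DependsOn f S) (z : (S → B) → (Sᶜ : Set A) → B) :
    expect (indepLaw μ) f =
      expect (indepLaw fun a : S => μ a) fun y =>
          f fun a => if h : a ∈ S then y ⟨a, h⟩ else z y ⟨a, h⟩ := by
  rw [expect_indepLaw_split μ S f]
  congr 1
  funext y
  rw [← expect_const (indepLaw fun a : (Sᶜ : Set A) => μ a)
    (f fun a => if h : a ∈ S then y ⟨a, h⟩ else z y ⟨a, h⟩)]
  congr 1
  funext z'
  exact hf fun a ha => by simp [ha]

/-- Conditioning on all members of an independent family but one. -/
theorem expect_indepLaw_le_of_update (μ : A → PMF B) (a : A) {f : (A → B) → ℝ} {r : ℝ}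
    (hf : ∀ x, expect (μ a) (fun b => f (Function.update x a b)) ≤ r) :
    expect (indepLaw μ) f ≤ r := by
  classical
  obtain ⟨S, hS⟩ : ∃ S : Set A, ∀ u, u ∈ S ↔ u = a := ⟨{a}, fun _ => Iff.rfl⟩
  rw [expect_indepLaw_split μ S f, expect_comm,
    ← expect_const (indepLaw fun u : (Sᶜ : Set A) => μ u) r]
  refine expect_mono _ fun z => ?_
  let y₀ : B := (μ a).support_nonempty.some
  refine le_trans (le_of_eq ?_) (hf fun u => if h : u ∈ S then y₀ else z ⟨u, h⟩)
  rw [← expect_indepLaw_eval (fun u : S => μ u) ⟨a, (hS a).2 rfl⟩]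
  congr 1
  funext y
  congr 1
  funext u
  by_cases h : u = a
  · subst h
    simp [hS]
  · have : u ∉ S := fun h' => h ((hS u).1 h')
    simp [h, this]

end Product

/-! ### Deterministic properties of the algorithm -/

section Dynamics

variable {V : Type*} {G : SimpleGraph V} {I : ℕ} {c : Config V}

theorem status_step_of_ne_active (x : V → NodeCoins I) {u : V} (h : c.status u ≠ Status.active) :
    (step G c x).status u = c.status u := if_neg h

theorem status_step_of_mem_joining {x : V → NodeCoins I} {u : V} (h : u ∈ joining G c x) :
    (step G c x).status u = Status.isIn := by
  simp [step, h, h.1]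

theorem status_step_of_adj_joining {x : V → NodeCoins I} {u w : V}
    (hu : c.status u = Status.active) (h : u ∉ joining G c x) (huw : G.Adj u w)
    (hw : w ∈ joining G c x) : (step G c x).status u = Status.isOut := by
  have : Hears G (joining G c x) u := ⟨h, w, huw, hw⟩
  simp [step, h, hu, this]

theorem status_step_of_forall_notMem {x : V → NodeCoins I} {u : V}
    (hu : c.status u = Status.active) (h : u ∉ joining G c x)
    (h' : ∀ w, G.Adj u w → w ∉ joining G c x) : (step G c x).status u = Status.active := by
  have : ¬ Hears G (joining G c x) u := fun ⟨_, w, huw, hw⟩ => h' w huw hw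
  simp [step, h, hu, this]

theorem active_of_active_step {x : V → NodeCoins I} {u : V}
    (h : (step G c x).status u = Status.active) : c.status u = Status.active := by
  by_contra hu
  exact hu (status_step_of_ne_active x hu ▸ h)

theorem notMem_joining_of_active_step {x : V → NodeCoins I} {u : V}
    (h : (step G c x).status u = Status.active) : u ∉ joining G c x := fun hu => by
  simp [status_step_of_mem_joining hu] at h

theorem mem_joining_of_isIn_step {x : V → NodeCoins I} {u : V}
    (hu : c.status u = Status.active) (h : (step G c x).status u = Status.isIn) :
    u ∈ joining G c x := by
  by_contra hj
  by_cases hh : ∃ w, G.Adj u w ∧ w ∈ joining G c x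
  · obtain ⟨w, huw, hw⟩ := hh
    simp [status_step_of_adj_joining hu hj huw hw] at h
  · push Not at hh
    simp [status_step_of_forall_notMem hu hj hh] at h

theorem exists_isIn_of_isOut_step {x : V → NodeCoins I} {u : V}
    (hu : c.status u = Status.active) (h : (step G c x).status u = Status.isOut) :
    ∃ w, G.Adj u w ∧ (step G c x).status w = Status.isIn := by
  have hj : u ∉ joining G c x := fun hj => by simp [status_step_of_mem_joining hj] at h
  by_contra hh
  push Not at hh
  have := status_step_of_forall_notMem hu hj fun w huw hw =>
    hh w huw (status_step_of_mem_joining hw)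
  simp [this] at h

/-- A marked node without marked active neighbors joins `M`. -/
theorem mem_joining_of_isolated {x : V → NodeCoins I} {u : V} (hu : c.status u = Status.active)
    (hm : (x u).marked = true)
    (h : ∀ w, G.Adj u w → c.status w = Status.active → (x w).marked ≠ true) :
    u ∈ joining G c x :=
  ⟨hu, hm, fun _ ⟨_, w, huw, hw⟩ => h w huw hw.1 hw.2.1⟩

/-- A node that joins `M` despite a marked neighbor has chosen the same slots as this neighbor:
the slots of the neighbor are contained in its own, and both sets have `I / 2` elements. -/
theorem slots_eq_of_mem_joining {x : V → NodeCoins I} {u w : V} (hu : u ∈ joining G c x)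
    (huw : G.Adj u w) (hw : c.status w = Status.active) (hm : (x w).marked = true) :
    (x u).slots = (x w).slots := by
  refine Subtype.ext (Finset.eq_of_subset_of_card_le (fun i hi => ?_) ?_).symm
  · by_contra hi'
    exact hu.2.2 i ⟨fun h => hi' h.2.2, w, huw, hw, hm, hi⟩
  · rw [(x u).slots.2, (x w).slots.2]

theorem mem_joining_congr {x y : V → NodeCoins I} {u : V} (hu : x u = y u)
    (h : ∀ w, G.Adj u w → x w = y w) : u ∈ joining G c x ↔ u ∈ joining G c y := by
  have hB : ∀ i, Hears G (secondBeepers c x i) u ↔ Hears G (secondBeepers c y i) u := fun i => by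
    simp only [Hears, secondBeepers, Set.mem_ofPred_eq, hu]
    refine and_congr_right fun _ => exists_congr fun w => and_congr_right fun huw => ?_
    rw [h w huw]
  simp only [joining, Set.mem_ofPred_eq, hu, hB]

theorem likelyHigh_congr {x y : V → NodeCoins I} {u : V} (hu : x u = y u)
    (h : ∀ w, G.Adj u w → x w = y w) : LikelyHigh G c x u ↔ LikelyHigh G c y u := by
  have hB : ∀ i, Hears G (firstBeepers c x i) u ↔ Hears G (firstBeepers c y i) u := fun i => by
    simp only [Hears, firstBeepers, Set.mem_ofPred_eq, hu]
    refine and_congr_right fun _ => exists_congr fun w => and_congr_right fun huw => ?_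
    rw [h w huw]
  have hf : ∀ i, u ∉ firstBeepers c x i ↔ u ∉ firstBeepers c y i := fun i => by
    simp [firstBeepers, hu]
  have hl : listenCount c x u = listenCount c y u := by
    unfold listenCount
    congr 1
    ext i
    simp [hf]
  have hb : beepCount G c x u = beepCount G c y u := by
    unfold beepCount
    congr 1
    ext i
    simp [hB]
  simp only [LikelyHigh, hu, hl, hb]

/-- In the configuration `c`, the node `v` has made a decision that is locally correct and will
remain so: it is OUT, or it is IN and all its neighbors are OUT. -/
def Settled (G : SimpleGraph V) (c : Config V) (v : V) : Prop :=
  c.status v = Status.isOut ∨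
    c.status v = Status.isIn ∧ ∀ u, G.Adj v u → c.status u = Status.isOut

theorem Settled.step {v : V} (h : Settled G c v) (x : V → NodeCoins I) :
    Settled G (step G c x) v := by
  rcases h with h | ⟨h, h'⟩
  · exact .inl ((status_step_of_ne_active x (by simp [h])).trans h)
  · refine .inr ⟨(status_step_of_ne_active x (by simp [h])).trans h, fun u hu => ?_⟩
    exact (status_step_of_ne_active x (by simp [h' u hu])).trans (h' u hu)

/-- In a reachable configuration, an active node has no neighbor in `M`. -/
theorem status_ne_isIn_of_adj_active (h : List (V → NodeCoins I)) {u w : V}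
    (hu : (config G h).status u = Status.active) (huw : G.Adj u w) :
    (config G h).status w ≠ Status.isIn := by
  induction h with
  | nil => simp [config, initial]
  | cons x h ih =>
    rw [config] at hu ⊢
    have hu' := active_of_active_step hu
    intro hw
    by_cases ha : (config G h).status w = Status.active
    · have hw' := mem_joining_of_isIn_step ha hw
      simp [status_step_of_adj_joining hu' (notMem_joining_of_active_step hu) huw hw'] at hu
    · exact ih hu' (status_step_of_ne_active x ha ▸ hw)

/-- The node `v` and a neighbor of it join `M` in the same round. -/
def Conflict (G : SimpleGraph V) (c : Config V) (x : V → NodeCoins I) (v : V) : Prop :=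
  v ∈ joining G c x ∧ ∃ u, G.Adj v u ∧ u ∈ joining G c x

/-- Neither `v` nor a neighbor of `v` joins `M`, so that `v` remains active. -/
def Stays (G : SimpleGraph V) (c : Config V) (x : V → NodeCoins I) (v : V) : Prop :=
  v ∉ joining G c x ∧ ∀ u, G.Adj v u → u ∉ joining G c x

/-- An active node settles in a round unless it stays active or there is a conflict. -/
theorem settled_step {h : List (V → NodeCoins I)} {x : V → NodeCoins I} {v : V}
    (hv : (config G h).status v = Status.active) (hc : ¬ Conflict G (config G h) x v)
    (hs : ¬ Stays G (config G h) x v) : Settled G (step G (config G h) x) v := by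
  by_cases hj : v ∈ joining G (config G h) x
  · refine .inr ⟨status_step_of_mem_joining hj, fun u huv => ?_⟩
    have hu : u ∉ joining G (config G h) x := fun hu => hc ⟨hj, u, huv, hu⟩
    cases ha : (config G h).status u with
    | active => exact status_step_of_adj_joining ha hu huv.symm hj
    | isIn => exact absurd ha (status_ne_isIn_of_adj_active h hv huv)
    | isOut => exact (status_step_of_ne_active x (by simp [ha])).trans ha
  · simp only [Stays, hj, not_false_eq_true, true_and] at hs
    push Not at hs
    obtain ⟨u, huv, hu⟩ := hs
    exact .inl (status_step_of_adj_joining hv hj huv hu)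

/-! ### From a settled node to a locally correct decision -/

theorem configAt_succ (h : List (V → NodeCoins I)) {s : ℕ} (hs : s < h.length) :
    ∃ x : V → NodeCoins I, configAt G h (s + 1) = step G (configAt G h s) x := by
  refine ⟨h[h.length - (s + 1)], ?_⟩
  rw [configAt, List.drop_eq_getElem_cons (by omega), config, configAt]
  congr 3
  omega

theorem configAt_zero (h : List (V → NodeCoins I)) : configAt G h 0 = initial V := by
  simp [configAt, config]

theorem status_configAt_of_le (h : List (V → NodeCoins I)) {s s' : ℕ} {u : V} (hss : s ≤ s')
    (hs' : s' ≤ h.length) (hu : (configAt G h s).status u ≠ Status.active) :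
    (configAt G h s').status u = (configAt G h s).status u := by
  induction s', hss using Nat.le_induction with
  | base => rfl
  | succ n hn ih =>
    obtain ⟨x, hx⟩ := configAt_succ (G := G) h (s := n) (by omega)
    have ih := ih (by omega)
    rw [hx, status_step_of_ne_active x (ih ▸ hu), ih]

theorem decidesCorrectly_of_settled {h : List (V → NodeCoins I)} {R : ℕ} {v : V}
    (hR : R ≤ h.length) (hv : Settled G (configAt G h R) v) : DecidesCorrectly G R v h := by
  have hna : (configAt G h R).status v ≠ Status.active := by
    rcases hv with hv | hv
    · simp [hv]
    · simp [hv.1]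
  classical
  have hex : ∃ s, (configAt G h s).status v ≠ Status.active := ⟨R, hna⟩
  obtain ⟨t, ht⟩ : ∃ t, Nat.find hex = t + 1 := Nat.exists_eq_succ_of_ne_zero fun h0 => by
    have := Nat.find_spec hex
    rw [h0, configAt_zero] at this
    exact this rfl
  have htR : t + 1 ≤ R := ht ▸ Nat.find_min' hex hna
  have hact : (configAt G h t).status v = Status.active := by
    by_contra hcon
    have := Nat.find_min' hex hcon
    omega
  have hdec : (configAt G h (t + 1)).status v ≠ Status.active := ht ▸ Nat.find_spec hex
  have hconst : ∀ s, t < s → s ≤ h.length →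
      (configAt G h s).status v = (configAt G h R).status v := fun s hs hs' =>
    (status_configAt_of_le h hs hs' hdec).trans (status_configAt_of_le h htR hR hdec).symm
  refine ⟨t, htR, by omega, hact, ?_⟩
  rcases hv with hv | ⟨hv, hv'⟩
  · refine .inr ⟨fun s hs hs' => (hconst s hs hs').trans hv, ?_⟩
    obtain ⟨x, hx⟩ := configAt_succ (G := G) h (s := t) (by omega)
    have hout := (hconst (t + 1) (by omega) (by omega)).trans hv
    rw [hx] at hout ⊢
    exact exists_isIn_of_isOut_step hact hout
  · refine .inl fun s hs hs' => ⟨(hconst s hs hs').trans hv, fun u hu hin => ?_⟩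
    rcases le_total s R with hsR | hsR
    · have := status_configAt_of_le (G := G) (u := u) h hsR hR (by simp [hin])
      exact absurd (this.symm.trans (hv' u hu)) (by simp [hin])
    · have := status_configAt_of_le (G := G) (u := u) h hsR hs' (by simp [hv' u hu])
      simp [this, hv' u hu] at hin

end Dynamics

/-! ### Probabilities and marginals of the coin tosses -/

open Classical in
/-- The indicator of a proposition. -/
def ind (P : Prop) : ℝ := if P then 1 else 0

theorem ind_of {P : Prop} (h : P) : ind P = 1 := if_pos h

theorem ind_of_not {P : Prop} (h : ¬ P) : ind P = 0 := if_neg h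

theorem ind_nonneg (P : Prop) : 0 ≤ ind P := by
  unfold ind
  split_ifs <;> norm_num

theorem ind_le_one (P : Prop) : ind P ≤ 1 := by
  unfold ind
  split_ifs <;> norm_num

theorem ind_and (P Q : Prop) : ind (P ∧ Q) = ind P * ind Q := by
  by_cases h : P <;> by_cases h' : Q <;> simp [ind, h, h']

theorem ind_le_of_imp {P : Prop} {r : ℝ} (hr : 0 ≤ r) (h : P → 1 ≤ r) : ind P ≤ r := by
  by_cases hP : P
  · rw [ind_of hP]
    exact h hP
  · rwa [ind_of_not hP]

/-- The probability of an event in a finite probability space. -/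
def prob {α : Type*} [Fintype α] (μ : PMF α) (E : α → Prop) : ℝ := expect μ fun a => ind (E a)

section Laws

variable {I : ℕ}

theorem nodeLaw_map_beep (p : ℝ≥0) (hp : p ≤ 1) :
    (nodeLaw I p hp).map NodeCoins.beep = indepLaw fun _ : Fin I => coinLaw p hp := by
  simp [nodeLaw, PMF.map_bind, PMF.pure_map, PMF.bind_const, PMF.bind_pure]

theorem prob_marked (p : ℝ≥0) (hp : p ≤ 1) :
    prob (nodeLaw I p hp) (fun y => y.marked = true) = p := by
  simp [prob, nodeLaw, expect_bind, expect_pure, expect_coinLaw, ind]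

/-- A node is marked and selects a given half of the slots. -/
theorem prob_marked_and_slots (p : ℝ≥0) (hp : p ≤ 1)
    (S : {S : Finset (Fin I) // S.card = I / 2}) :
    prob (nodeLaw I p hp) (fun y => y.marked = true ∧ y.slots = S) =
      p / (I.choose (I / 2) : ℝ) := by
  have hcard : Fintype.card {S : Finset (Fin I) // S.card = I / 2} = I.choose (I / 2) := by
    rw [Fintype.card_finset_len, Fintype.card_fin]
  have hS : expect (PMF.uniformOfFintype {S : Finset (Fin I) // S.card = I / 2})
      (fun S' => ind (S' = S)) = 1 / (I.choose (I / 2) : ℝ) := by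
    simp [expect, ind, hcard]
  simp [prob, nodeLaw, expect_bind, expect_pure, expect_coinLaw, ind_and, expect_const_mul, hS]
  simp [ind, div_eq_mul_inv]

theorem coe_desire_le {V : Type*} (c : Config V) (u : V) : (c.desire u : ℝ) ≤ 1 / 2 := by
  have : ((c.desire u : ℝ≥0) : ℝ) ≤ ((1 / 2 : ℝ≥0) : ℝ) := NNReal.coe_le_coe.2 (c.desire_le u)
  simpa using this

variable {V : Type*} [Fintype V]

open Classical in
/-- The law of the coin tosses of all nodes in a round that starts in the configuration `c`. -/
def coinsLaw (I : ℕ) (c : Config V) : PMF (V → NodeCoins I) :=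
  indepLaw fun u => nodeLaw I (c.desire u) (desire_le_one c u)

variable (G : SimpleGraph V)

open Classical in
/-- The active neighbors of a node. -/
def activeNbrs (c : Config V) (u : V) : Finset V :=
  Finset.univ.filter fun w => G.Adj u w ∧ c.status w = Status.active

/-- The sum `d_t(u)` of the desire-levels of the active neighbors of `u`. -/
def load (c : Config V) (u : V) : ℝ := ∑ w ∈ activeNbrs G c u, (c.desire w : ℝ)

variable {G}

theorem mem_activeNbrs {c : Config V} {u w : V} :
    w ∈ activeNbrs G c u ↔ G.Adj u w ∧ c.status w = Status.active := by
  simp [activeNbrs]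

theorem notMem_activeNbrs_self {c : Config V} {u : V} : u ∉ activeNbrs G c u := by
  simp [mem_activeNbrs]

theorem load_nonneg (c : Config V) (u : V) : 0 ≤ load G c u :=
  Finset.sum_nonneg fun _ _ => NNReal.coe_nonneg _

/-! ### Quality of the load estimates -/

/-- The weight of the outcome of one slot of the first interval, for a node `u` with the active
neighbors `N`: `a` if `u` beeps, `r` if it listens and hears a beep, and `s` if it listens and hears
nothing. -/
def slotWeight (N : Finset V) (u : V) (a s r : ℝ) (β : V → Bool) : ℝ :=
  open Classical in if β u = true then a else if ∃ w ∈ N, β w = true then r else s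

open Classical in
theorem expect_slotWeight (c : Config V) (u : V) (a s r : ℝ) :
    expect (indepLaw fun w => coinLaw (c.desire w) (desire_le_one c w))
        (slotWeight (activeNbrs G c u) u a s r) =
      c.desire u * a + (1 - c.desire u) *
        (r + (s - r) * ∏ w ∈ activeNbrs G c u, (1 - (c.desire w : ℝ))) := by
  have hw : ∀ β : V → Bool, slotWeight (activeNbrs G c u) u a s r β =
      (a * (if β u = true then 1 else 0) + r * (if β u = true then 0 else 1)) +
      (s - r) * ∏ w, if w ∈ insert u (activeNbrs G c u) then (if β w = true then 0 else 1)
        else 1 := by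
    intro β
    rw [Finset.prod_ite_mem, Finset.univ_inter, Finset.prod_insert notMem_activeNbrs_self,
      slotWeight]
    by_cases hu : β u = true
    · simp [hu]
    · by_cases hN : ∃ w ∈ activeNbrs G c u, β w = true
      · obtain ⟨w, hw, hw'⟩ := hN
        rw [if_neg hu, if_pos ⟨w, hw, hw'⟩, Finset.prod_eq_zero hw (by simp [hw'])]
        simp [hu]
      · rw [if_neg hu, if_neg hN, Finset.prod_eq_one]
        · simp [hu]
        · intro w hw
          push Not at hN
          simp [hN w hw]
  have hprod : expect (indepLaw fun w => coinLaw (c.desire w) (desire_le_one c w))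
      (fun β => ∏ w, if w ∈ insert u (activeNbrs G c u) then (if β w = true then (0 : ℝ) else 1)
        else 1) = (1 - c.desire u) * ∏ w ∈ activeNbrs G c u, (1 - (c.desire w : ℝ)) := by
    rw [expect_indepLaw_prod _ fun w b =>
      if w ∈ insert u (activeNbrs G c u) then (if b = true then (0 : ℝ) else 1) else 1,
      ← Finset.prod_insert (f := fun w => 1 - (c.desire w : ℝ)) notMem_activeNbrs_self,
      ← Finset.univ_inter (insert u (activeNbrs G c u)), ← Finset.prod_ite_mem]
    refine Finset.prod_congr rfl fun w _ => ?_
    by_cases hw : w ∈ insert u (activeNbrs G c u)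
    · simp only [Finset.univ_inter, hw, if_true, expect_coinLaw]
      simp
    · simp [hw]
  rw [funext hw, expect_add, expect_const_mul, hprod, expect_indepLaw_eval
    (fun w => coinLaw (c.desire w) (desire_le_one c w)) u
    fun b => a * (if b = true then 1 else 0) + r * (if b = true then 0 else 1), expect_coinLaw]
  simp
  ring

theorem prod_slotWeight {c : Config V} {u : V} (hu : c.status u = Status.active)
    (x : V → NodeCoins I) (a s r : ℝ) :
    ∃ n m : ℕ, n + listenCount c x u = I ∧ m + beepCount G c x u = listenCount c x u ∧
      ∏ i, slotWeight (activeNbrs G c u) u a s r (fun w => (x w).beep i) =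
        a ^ n * (r ^ beepCount G c x u * s ^ m) := by
  classical
  have hl : ∀ i, u ∉ firstBeepers c x i ↔ ¬ (x u).beep i = true := by
    simp [firstBeepers, hu]
  have hh : ∀ i, Hears G (firstBeepers c x i) u ↔
      ¬ (x u).beep i = true ∧ ∃ w ∈ activeNbrs G c u, (x w).beep i = true := fun i => by
    rw [Hears, hl]
    simp [mem_activeNbrs, firstBeepers, and_assoc]
  have hlc : listenCount c x u = (Finset.univ.filter fun i => ¬ (x u).beep i = true).card := by
    unfold listenCount
    congr 1
    ext i
    simp [hl]
  have hbc : beepCount G c x u = ((Finset.univ.filter fun i => ¬ (x u).beep i = true).filter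
      fun i => ∃ w ∈ activeNbrs G c u, (x w).beep i = true).card := by
    unfold beepCount
    congr 1
    ext i
    simp [hh]
  refine ⟨(Finset.univ.filter fun i => (x u).beep i = true).card,
    ((Finset.univ.filter fun i => ¬ (x u).beep i = true).filter
      fun i => ¬ ∃ w ∈ activeNbrs G c u, (x w).beep i = true).card, ?_, ?_, ?_⟩
  · rw [hlc, Finset.card_filter_add_card_filter_not, Finset.card_univ, Fintype.card_fin]
  · rw [hlc, hbc, add_comm, Finset.card_filter_add_card_filter_not]
  · unfold slotWeight
    rw [Finset.prod_ite, Finset.prod_ite, hbc]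
    simp only [Finset.prod_const]

open Classical in
/-- An exponential moment bound for events that depend on the counters of `u`. The slots of the first
interval are independent and identically distributed, so the expectation of the product of the
weights is a power of the expected weight of one slot. -/
theorem prob_le_of_one_le_weight {c : Config V} {u : V} (hu : c.status u = Status.active)
    {a s r κ : ℝ} (ha : 0 ≤ a) (hs : 0 ≤ s) (hr : 0 ≤ r) {E : (V → NodeCoins I) → Prop}
    (hE : ∀ x, E x → ∀ n m, n + listenCount c x u = I →
      m + beepCount G c x u = listenCount c x u →
      1 ≤ a ^ n * (r ^ beepCount G c x u * s ^ m))
    (hκ : c.desire u * a + (1 - c.desire u) *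
        (r + (s - r) * ∏ w ∈ activeNbrs G c u, (1 - (c.desire w : ℝ))) ≤ 1 - κ) :
    prob (coinsLaw I c) E ≤ Real.exp (-(κ * I)) := by
  have hw : ∀ β, 0 ≤ slotWeight (activeNbrs G c u) u a s r β := fun β => by
    unfold slotWeight
    split_ifs <;> assumption
  have h1 : prob (coinsLaw I c) E ≤ expect (coinsLaw I c) fun x =>
      ∏ i, slotWeight (activeNbrs G c u) u a s r (fun w => (x w).beep i) := by
    refine expect_mono _ fun x => ind_le_of_imp (Finset.prod_nonneg fun i _ => hw _) fun hx => ?_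
    obtain ⟨n, m, hn, hm, h⟩ := prod_slotWeight (G := G) hu x a s r
    rw [h]
    exact hE x hx n m hn hm
  refine h1.trans ?_
  rw [coinsLaw, expect_indepLaw_comp _ NodeCoins.beep fun b =>
      ∏ i, slotWeight (activeNbrs G c u) u a s r (fun w => b w i)]
  simp only [nodeLaw_map_beep]
  rw [expect_indepLaw_array (J := Fin I), Fintype.card_fin]
  have h0 := expect_nonneg (indepLaw fun w => coinLaw (c.desire w) (desire_le_one c w)) hw
  rw [expect_slotWeight] at h0 ⊢
  refine (pow_le_pow_left₀ h0 (hκ.trans (Real.one_sub_le_exp_neg κ)) I).trans (le_of_eq ?_)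
  rw [← Real.exp_nat_mul]
  congr 1
  ring

theorem exp_neg_mul_le {n : ℝ} (hn : 14000 ≤ n) : Real.exp (-(1 / 1000 * n)) ≤ 1 / 2000 := by
  have h1 : (2000 : ℝ) ≤ Real.exp 8 := by
    have h := Real.exp_one_gt_d9
    have h8 : Real.exp 8 = Real.exp 1 ^ 8 := by
      rw [← Real.exp_nat_mul]
      norm_num
    rw [h8]
    calc (2000 : ℝ) ≤ 2.7 ^ 8 := by norm_num
      _ ≤ Real.exp 1 ^ 8 := by gcongr; linarith
  have h2 : Real.exp 8 ≤ Real.exp (1 / 1000 * n) := Real.exp_le_exp.2 (by linarith)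
  rw [Real.exp_neg, ← one_div]
  exact one_div_le_one_div_of_le (by norm_num) (h1.trans h2)

open Classical in
/-- A node rarely listens in at most a third of the slots, as it beeps with probability at
most `1/2`. -/
theorem prob_listenCount_le {c : Config V} {u : V} (hI : 14000 ≤ I)
    (hu : c.status u = Status.active) :
    prob (coinsLaw I c) (fun x => (listenCount c x u : ℝ) ≤ I / 3) ≤ 1 / 2000 := by
  have hp := coe_desire_le c u
  refine (prob_le_of_one_le_weight (G := ⊥) (a := 11 / 10) (s := (10 / 11) ^ 2)
    (r := (10 / 11) ^ 2) (κ := 1 / 1000) hu (by norm_num) (by norm_num) (by norm_num) ?_ ?_).trans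
    (exp_neg_mul_le (by exact_mod_cast hI))
  · intro x hx n m hn hm
    -- Listening in at most `I / 3` slots means beeping at least twice as often as listening.
    have h2 : 2 * listenCount c x u ≤ n := by
      have : (n : ℝ) + listenCount c x u = I := by exact_mod_cast hn
      have : (2 * listenCount c x u : ℝ) ≤ n := by linarith
      exact_mod_cast this
    rw [← pow_add, add_comm _ m, hm, ← pow_mul]
    calc (1 : ℝ) = (11 / 10) ^ (2 * listenCount c x u) * (10 / 11) ^ (2 * listenCount c x u) := by
          rw [← mul_pow]
          norm_num
      _ ≤ _ := by gcongr; norm_num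
  · rw [sub_self, zero_mul, add_zero]
    nlinarith

theorem prod_one_sub_le_inv_one_add_sum {ι : Type*} (s : Finset ι) {p : ι → ℝ}
    (hp0 : ∀ i, 0 ≤ p i) (hp1 : ∀ i, p i ≤ 1) :
    (∏ i ∈ s, (1 - p i)) * (1 + ∑ i ∈ s, p i) ≤ 1 := by
  classical
  induction s using Finset.induction_on with
  | empty => simp
  | insert i s hi ih =>
    rw [Finset.prod_insert hi, Finset.sum_insert hi]
    have hP : 0 ≤ ∏ i ∈ s, (1 - p i) := Finset.prod_nonneg fun j _ => sub_nonneg.2 (hp1 j)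
    have hS : 0 ≤ ∑ i ∈ s, p i := Finset.sum_nonneg fun j _ => hp0 j
    nlinarith [mul_nonneg hP (mul_nonneg (hp0 i) hS), mul_nonneg hP (sq_nonneg (p i))]

theorem one_sub_sum_le_prod_one_sub {ι : Type*} (s : Finset ι) {p : ι → ℝ}
    (hp0 : ∀ i, 0 ≤ p i) (hp1 : ∀ i, p i ≤ 1) :
    1 - ∑ i ∈ s, p i ≤ ∏ i ∈ s, (1 - p i) := by
  classical
  induction s using Finset.induction_on with
  | empty => simp
  | insert i s hi ih =>
    rw [Finset.prod_insert hi, Finset.sum_insert hi]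
    have hS : 0 ≤ ∑ i ∈ s, p i := Finset.sum_nonneg fun j _ => hp0 j
    nlinarith [mul_nonneg (hp0 i) hS, mul_le_mul_of_nonneg_left ih (sub_nonneg.2 (hp1 i))]

open Classical in
/-- A node with load at least `1/2` is likely to recognize this: in a slot in which it listens it
hears a beep with probability at least `1/3 > 1/5`. -/
theorem prob_not_likelyHigh_le {c : Config V} {u : V} (hI : 14000 ≤ I)
    (hu : c.status u = Status.active) (hd : 1 / 2 ≤ load G c u) :
    prob (coinsLaw I c) (fun x => ¬ LikelyHigh G c x u) ≤ 1 / 1000 := by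
  have hp := coe_desire_le c u
  have hq : ∏ w ∈ activeNbrs G c u, (1 - (c.desire w : ℝ)) ≤ 2 / 3 := by
    have h := prod_one_sub_le_inv_one_add_sum (activeNbrs G c u)
      (p := fun w => (c.desire w : ℝ)) (fun w => NNReal.coe_nonneg _)
      (fun w => (coe_desire_le c w).trans (by norm_num))
    have hP : 0 ≤ ∏ w ∈ activeNbrs G c u, (1 - (c.desire w : ℝ)) :=
      Finset.prod_nonneg fun w _ => by linarith [coe_desire_le c w]
    unfold load at hd
    nlinarith
  -- A beep is heard in at most a fifth of the slots with listening iff these include at least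
  -- four times as many silent slots; hence the fourth power in the weight of a beep.
  have key : prob (coinsLaw I c)
      (fun x => 4 * beepCount G c x u + beepCount G c x u ≤ listenCount c x u) ≤ 1 / 2000 := by
    refine (prob_le_of_one_le_weight (G := G) (a := 1) (s := 11 / 10)
      (r := (10 / 11) ^ 4) (κ := 1 / 1000) hu (by norm_num) (by norm_num) (by norm_num) ?_ ?_).trans
      (exp_neg_mul_le (by exact_mod_cast hI))
    · intro x hx n m hn hm
      have h4 : 4 * beepCount G c x u ≤ m := by omega
      rw [one_pow, one_mul, ← pow_mul]
      calc (1 : ℝ) = (10 / 11) ^ (4 * beepCount G c x u) * (11 / 10) ^ (4 * beepCount G c x u) := by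
            rw [← mul_pow]
            norm_num
        _ ≤ _ := by gcongr; norm_num
    · nlinarith
  calc _ ≤ expect (coinsLaw I c) (fun x => ind ((listenCount c x u : ℝ) ≤ I / 3) +
        ind (4 * beepCount G c x u + beepCount G c x u ≤ listenCount c x u)) := by
        refine expect_mono _ fun x =>
          ind_le_of_imp (add_nonneg (ind_nonneg _) (ind_nonneg _)) fun hx => ?_
        by_cases hl : (listenCount c x u : ℝ) ≤ I / 3
        · rw [ind_of hl]
          linarith [ind_nonneg (4 * beepCount G c x u + beepCount G c x u ≤ listenCount c x u)]
        · have hl0 : (0 : ℝ) < listenCount c x u := lt_of_le_of_lt (by positivity) (not_le.1 hl)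
          have hb : (beepCount G c x u : ℝ) / listenCount c x u ≤ 1 / 5 := by
            by_contra hb
            exact hx (.inl ⟨not_le.1 hl, not_le.1 hb⟩)
          rw [div_le_iff₀ hl0] at hb
          have h5 : (4 * beepCount G c x u + beepCount G c x u : ℝ) ≤ listenCount c x u := by
            linarith
          rw [ind_of (P := 4 * beepCount G c x u + beepCount G c x u ≤ listenCount c x u)
            (by exact_mod_cast h5)]
          linarith [ind_nonneg ((listenCount c x u : ℝ) ≤ I / 3)]
    _ ≤ 1 / 1000 := by
        rw [expect_add]
        have := prob_listenCount_le hI hu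
        unfold prob at this key
        linarith

open Classical in
/-- A node with load at most `4/25` is likely to recognize this: in a slot in which it listens it
hears a beep with probability at most `4/25 < 1/5`. -/
theorem prob_likelyHigh_le {c : Config V} {u : V} (hI : 14000 ≤ I)
    (hu : c.status u = Status.active) (hd : load G c u ≤ 4 / 25) :
    prob (coinsLaw I c) (fun x => LikelyHigh G c x u) ≤ 1 / 1000 := by
  have hp := coe_desire_le c u
  have hq : 21 / 25 ≤ ∏ w ∈ activeNbrs G c u, (1 - (c.desire w : ℝ)) := by
    have h := one_sub_sum_le_prod_one_sub (activeNbrs G c u)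
      (p := fun w => (c.desire w : ℝ)) (fun w => NNReal.coe_nonneg _)
      (fun w => (coe_desire_le c w).trans (by norm_num))
    unfold load at hd
    linarith
  have key : prob (coinsLaw I c)
      (fun x => listenCount c x u ≤ 4 * beepCount G c x u + beepCount G c x u) ≤ 1 / 2000 := by
    refine (prob_le_of_one_le_weight (G := G) (a := 1) (s := 10 / 11)
      (r := (11 / 10) ^ 4) (κ := 1 / 1000) hu (by norm_num) (by norm_num) (by norm_num) ?_ ?_).trans
      (exp_neg_mul_le (by exact_mod_cast hI))
    · intro x hx n m hn hm
      have h4 : m ≤ 4 * beepCount G c x u := by omega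
      rw [one_pow, one_mul, ← pow_mul]
      calc (1 : ℝ) = (11 / 10) ^ m * (10 / 11) ^ m := by
            rw [← mul_pow]
            norm_num
        _ ≤ _ := by gcongr; norm_num
    · nlinarith
  calc _ ≤ expect (coinsLaw I c) (fun x => ind ((listenCount c x u : ℝ) ≤ I / 3) +
        ind (listenCount c x u ≤ 4 * beepCount G c x u + beepCount G c x u)) := by
        refine expect_mono _ fun x =>
          ind_le_of_imp (add_nonneg (ind_nonneg _) (ind_nonneg _)) fun hx => ?_
        rcases hx with ⟨hl, hb⟩ | ⟨hl, -⟩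
        · have hl0 : (0 : ℝ) < listenCount c x u := lt_of_le_of_lt (by positivity) hl
          rw [lt_div_iff₀ hl0] at hb
          have h5 : (listenCount c x u : ℝ) ≤ 4 * beepCount G c x u + beepCount G c x u := by
            linarith
          rw [ind_of (P := listenCount c x u ≤ 4 * beepCount G c x u + beepCount G c x u)
            (by exact_mod_cast h5)]
          linarith [ind_nonneg ((listenCount c x u : ℝ) ≤ I / 3)]
        · rw [ind_of hl]
          linarith [ind_nonneg (listenCount c x u ≤ 4 * beepCount G c x u + beepCount G c x u)]
    _ ≤ 1 / 1000 := by
        rw [expect_add]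
        have := prob_listenCount_le hI hu
        unfold prob at this key
        linarith

end Laws

/-! ### The desire-levels after a round -/

section DesireLevels

open scoped Classical

variable {V : Type*} {G : SimpleGraph V} {I : ℕ} {c : Config V} {u : V}

theorem desire_step (hu : c.status u = Status.active) (x : V → NodeCoins I) :
    ((step G c x).desire u : ℝ) =
      if LikelyHigh G c x u then (c.desire u : ℝ) / 2 else min (2 * c.desire u) (1 / 2) := by
  simp only [step, hu, if_true]
  split_ifs <;> simp

theorem desire_step_le_two_mul (hu : c.status u = Status.active) (x : V → NodeCoins I) :
    ((step G c x).desire u : ℝ) ≤ 2 * c.desire u := by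
  rw [desire_step hu]
  split_ifs
  · linarith [(c.desire u).coe_nonneg]
  · exact min_le_left _ _

theorem half_le_desire_step (hu : c.status u = Status.active) (x : V → NodeCoins I) :
    (c.desire u : ℝ) / 2 ≤ (step G c x).desire u := by
  rw [desire_step hu]
  split_ifs
  · exact le_rfl
  · exact le_min (by linarith [(c.desire u).coe_nonneg]) (by linarith [coe_desire_le c u])

theorem desire_step_le (hu : c.status u = Status.active) (x : V → NodeCoins I) :
    ((step G c x).desire u : ℝ) ≤
      c.desire u / 2 + 3 / 2 * c.desire u * ind (¬ LikelyHigh G c x u) := by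
  by_cases h : LikelyHigh G c x u
  · rw [desire_step hu, if_pos h, ind_of_not (not_not.2 h)]
    linarith
  · rw [ind_of h]
    linarith [desire_step_le_two_mul (G := G) hu x]

theorem desire_div_desire_step_le_two (hu : c.status u = Status.active) (hp : 0 < c.desire u)
    (x : V → NodeCoins I) : (c.desire u : ℝ) / (step G c x).desire u ≤ 2 := by
  have hp' : (0 : ℝ) < c.desire u := hp
  have h := half_le_desire_step (G := G) hu x
  rw [div_le_iff₀ (by linarith)]
  linarith

end DesireLevels

/-! ### The probability that a node remains active -/

section OneRound

open scoped Classical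

variable {V : Type*} [Fintype V] {G : SimpleGraph V} {I : ℕ} {c : Config V} {u v w : V}

theorem expect_marked (c : Config V) (u : V) :
    expect (coinsLaw I c) (fun x => ind ((x u).marked = true)) = c.desire u :=
  (expect_indepLaw_eval _ u fun y : NodeCoins I => ind (y.marked = true)).trans
    (prob_marked _ _)

theorem expect_marked_mul_marked (c : Config V) (h : u ≠ w) :
    expect (coinsLaw I c) (fun x => ind ((x u).marked = true) * ind ((x w).marked = true)) =
      c.desire u * c.desire w :=
  (expect_indepLaw_eval_mul_eval _ h (fun y : NodeCoins I => ind (y.marked = true))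
    fun y => ind (y.marked = true)).trans (congrArg₂ _ (prob_marked _ _) (prob_marked _ _))

/-- The node `u` is marked and none of its active neighbors is. -/
def IsolatedMark (G : SimpleGraph V) (c : Config V) (x : V → NodeCoins I) (u : V) : Prop :=
  (x u).marked = true ∧ ∀ w ∈ activeNbrs G c u, (x w).marked ≠ true

theorem IsolatedMark.mem_joining {x : V → NodeCoins I} (h : IsolatedMark G c x u)
    (hu : c.status u = Status.active) : u ∈ joining G c x :=
  mem_joining_of_isolated hu h.1 fun w huw hw => h.2 w (mem_activeNbrs.2 ⟨huw, hw⟩)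

theorem le_prob_isolatedMark (c : Config V) (u : V) :
    c.desire u * (1 - load G c u) ≤ prob (coinsLaw I c) fun x => IsolatedMark G c x u := by
  have h : ∀ x : V → NodeCoins I, ind ((x u).marked = true) -
      ∑ w ∈ activeNbrs G c u, ind ((x u).marked = true) * ind ((x w).marked = true) ≤
      ind (IsolatedMark G c x u) := by
    intro x
    by_cases hm : (x u).marked = true
    · by_cases hi : ∃ w ∈ activeNbrs G c u, (x w).marked = true
      · obtain ⟨w, hw, hw'⟩ := hi
        have := Finset.single_le_sum (f := fun w => ind ((x u).marked = true) *
          ind ((x w).marked = true)) (fun w _ => mul_nonneg (ind_nonneg _) (ind_nonneg _)) hw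
        simp only [ind_of hm, ind_of hw', one_mul] at this ⊢
        linarith [ind_nonneg (IsolatedMark G c x u)]
      · push Not at hi
        rw [ind_of (P := IsolatedMark G c x u) ⟨hm, hi⟩, ind_of hm]
        linarith [Finset.sum_nonneg fun w (_ : w ∈ activeNbrs G c u) =>
          mul_nonneg zero_le_one (ind_nonneg ((x w).marked = true))]
    · simp only [ind_of_not hm, zero_mul, Finset.sum_const_zero, sub_zero]
      exact ind_nonneg _
  refine le_trans (le_of_eq ?_) (expect_mono _ h)
  rw [expect_sub, expect_marked, expect_sum, load, mul_sub, mul_one, Finset.mul_sum]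
  congr 1
  refine Finset.sum_congr rfl fun w hw => (expect_marked_mul_marked c ?_).symm
  rintro rfl
  exact notMem_activeNbrs_self hw

theorem prob_stays_le_of_self (hv : c.status v = Status.active) :
    prob (coinsLaw I c) (fun x => Stays G c x v) ≤ 1 - c.desire v * (1 - load G c v) := by
  have h : prob (coinsLaw I c) (fun x => Stays G c x v) ≤
      expect (coinsLaw I c) fun x => 1 - ind (IsolatedMark G c x v) := by
    refine expect_mono _ fun x => ?_
    by_cases hi : IsolatedMark G c x v
    · rw [ind_of_not fun hs : Stays G c x v => hs.1 (hi.mem_joining hv), ind_of hi, sub_self]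
    · rw [ind_of_not hi, sub_zero]
      exact ind_le_one _
  rw [expect_sub, expect_const] at h
  have h' := le_prob_isolatedMark (I := I) (G := G) c v
  unfold prob at h' ⊢
  unfold prob at h
  linarith

/-- Neighbors with small loads remove `v` with a probability that grows with the sum `r` of their
desire-levels. If `X` counts those of them that carry an isolated mark, then `X = 0` if `v` stays
active, and the bound follows from `𝔼 X ≥ r / 2` and `𝔼 X² ≤ r + r²`. -/
theorem prob_stays_le_of_light {L : Finset V} (hL : L ⊆ activeNbrs G c v)
    (hl : ∀ u ∈ L, load G c u ≤ 1 / 2) {r : ℝ} (hr : ∑ u ∈ L, (c.desire u : ℝ) = r) :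
    prob (coinsLaw I c) (fun x => Stays G c x v) ≤ 1 - r / (4 * (1 + r)) := by
  have hr0 : 0 ≤ r := hr ▸ Finset.sum_nonneg fun u _ => NNReal.coe_nonneg _
  set J : V → (V → NodeCoins I) → ℝ := fun u x => ind (IsolatedMark G c x u) with hJ
  have hJM : ∀ u x, J u x ≤ ind ((x u).marked = true) := fun u x => by
    refine ind_le_of_imp (ind_nonneg _) fun h => ?_
    rw [ind_of h.1]
  have h1 : r / 2 ≤ expect (coinsLaw I c) fun x => ∑ u ∈ L, J u x := by
    rw [expect_sum, ← hr, Finset.sum_div]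
    refine Finset.sum_le_sum fun u hu => le_trans ?_ (le_prob_isolatedMark (G := G) c u)
    nlinarith [hl u hu, (c.desire u).coe_nonneg]
  have h2 : expect (coinsLaw I c) (fun x => (∑ u ∈ L, J u x) * ∑ w ∈ L, J w x) ≤ r + r * r := by
    simp only [Finset.sum_mul_sum]
    rw [expect_sum, ← hr, Finset.sum_mul_sum, ← Finset.sum_add_distrib]
    refine Finset.sum_le_sum fun u hu => ?_
    rw [expect_sum]
    have : ∀ w ∈ L, expect (coinsLaw I c) (fun x => J u x * J w x) ≤
        (if w = u then (c.desire u : ℝ) else 0) + c.desire u * c.desire w := by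
      intro w _
      by_cases huw : w = u
      · rw [if_pos huw, ← expect_marked (I := I) c u]
        refine le_trans (expect_mono _ fun x => ?_) (le_add_of_nonneg_right ?_)
        · exact (mul_le_of_le_one_right (ind_nonneg _) (ind_le_one _)).trans (hJM u x)
        · rw [expect_marked]
          positivity
      · rw [if_neg huw, zero_add, ← expect_marked_mul_marked c (Ne.symm huw)]
        exact expect_mono _ fun x =>
          mul_le_mul (hJM u x) (hJM w x) (ind_nonneg _) (ind_nonneg _)
    refine (Finset.sum_le_sum this).trans (le_of_eq ?_)
    rw [Finset.sum_add_distrib, Finset.sum_ite_eq', if_pos hu]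
  have h3 : ∀ x, ind (Stays G c x v) ≤ 1 - 1 / (1 + r) * (∑ u ∈ L, J u x) +
      (1 / (2 * (1 + r))) ^ 2 * ((∑ u ∈ L, J u x) * ∑ w ∈ L, J w x) := by
    intro x
    have hsq : 1 - 1 / (1 + r) * (∑ u ∈ L, J u x) +
      (1 / (2 * (1 + r))) ^ 2 * ((∑ u ∈ L, J u x) * ∑ w ∈ L, J w x) =
      (1 - 1 / (2 * (1 + r)) * ∑ u ∈ L, J u x) ^ 2 := by
      field_simp
      ring
    rw [hsq]
    refine ind_le_of_imp (sq_nonneg _) fun hs => ?_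
    rw [Finset.sum_eq_zero fun u hu => ?_]
    · norm_num
    · have huv := mem_activeNbrs.1 (hL hu)
      exact ind_of_not fun hi => hs.2 u huv.1 (hi.mem_joining huv.2)
  refine (expect_mono _ h3).trans ?_
  rw [expect_add, expect_sub, expect_const, expect_const_mul, expect_const_mul]
  have e1 : 1 / (1 + r) * (r / 2) ≤
      1 / (1 + r) * expect (coinsLaw I c) fun x => ∑ u ∈ L, J u x := by gcongr
  have e2 : (1 / (2 * (1 + r))) ^ 2 * expect (coinsLaw I c)
      (fun x => (∑ u ∈ L, J u x) * ∑ w ∈ L, J w x) ≤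
      (1 / (2 * (1 + r))) ^ 2 * (r + r * r) := by gcongr
  have e3 : (1 / (2 * (1 + r))) ^ 2 * (r + r * r) = r / (4 * (1 + r)) := by
    field_simp
    ring
  have e4 : 1 / (1 + r) * (r / 2) = 2 * (r / (4 * (1 + r))) := by
    field_simp
    ring
  linarith

/-! ### Conflicts -/

/-- Given all coin tosses but those of `v`, a conflict requires that `v` is marked and chooses the
slots of a marked neighbor. -/
theorem prob_conflict_le (c : Config V) (v : V) :
    prob (coinsLaw I c) (fun x => Conflict G c x v) ≤ c.desire v / (I.choose (I / 2) : ℝ) := by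
  refine expect_indepLaw_le_of_update _ v fun x => ?_
  by_cases h : ∃ u, G.Adj v u ∧ c.status u = Status.active ∧ (x u).marked = true
  · obtain ⟨u, huv, hu, hm⟩ := h
    rw [← prob_marked_and_slots (c.desire v) (desire_le_one c v) (x u).slots]
    refine expect_mono _ fun b => ind_le_of_imp (ind_nonneg _) fun hc => ?_
    have hxu : Function.update x v b u = x u := Function.update_of_ne huv.ne' _ _
    have hs := slots_eq_of_mem_joining hc.1 huv hu (by rw [hxu]; exact hm)
    have hmv := hc.1.2.1
    rw [Function.update_self] at hs hmv
    rw [hxu] at hs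
    rw [ind_of ⟨hmv, hs⟩]
  · refine le_trans (le_of_eq ?_) (by positivity : 0 ≤ (c.desire v : ℝ) / (I.choose (I / 2) : ℝ))
    rw [← expect_const (nodeLaw I (c.desire v) (desire_le_one c v)) 0]
    congr 1
    funext b
    refine ind_of_not ?_
    rintro ⟨-, u, huv, hu⟩
    have hm := hu.2.1
    rw [Function.update_of_ne huv.ne'] at hm
    exact h ⟨u, huv, hu.1, hm⟩

/-! ### Loads and desire-levels after a round -/

theorem expect_desire_step_le (hI : 14000 ≤ I) (hu : c.status u = Status.active)
    (hd : 1 / 2 ≤ load G c u) :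
    expect (coinsLaw I c) (fun x => ((step G c x).desire u : ℝ)) ≤
      c.desire u / 2 + 3 / 2000 * c.desire u := by
  refine (expect_mono _ (desire_step_le hu)).trans ?_
  rw [expect_add, expect_const, expect_const_mul]
  have := prob_not_likelyHigh_le hI hu hd
  unfold prob at this
  nlinarith [(c.desire u).coe_nonneg]

theorem expect_desire_div_le (hI : 14000 ≤ I) (hu : c.status u = Status.active)
    (hp : 0 < c.desire u) (hp' : (c.desire u : ℝ) ≤ 1 / 4) (hd : load G c u ≤ 4 / 25) :
    expect (coinsLaw I c) (fun x => (c.desire u : ℝ) / (step G c x).desire u) ≤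
      1 / 2 + 3 / 2000 := by
  have hp0 : (0 : ℝ) < c.desire u := hp
  have h : ∀ x : V → NodeCoins I, (c.desire u : ℝ) / (step G c x).desire u ≤
      1 / 2 + 3 / 2 * ind (LikelyHigh G c x u) := by
    intro x
    by_cases hx : LikelyHigh G c x u
    · rw [ind_of hx]
      linarith [desire_div_desire_step_le_two (G := G) hu hp x]
    · rw [ind_of_not hx, desire_step hu, if_neg hx, min_eq_left (by linarith),
        div_le_iff₀ (by linarith)]
      linarith
  refine (expect_mono _ h).trans ?_
  rw [expect_add, expect_const, expect_const_mul]
  have := prob_likelyHigh_le hI hu hd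
  unfold prob at this
  linarith

/-- The sum of the new desire-levels of those neighbors of `v` that were active before the round. It
bounds the new load of `v`, and other than the latter it is determined by the coin tosses of the
nodes at distance at most two. -/
def nextLoad (G : SimpleGraph V) (c : Config V) (x : V → NodeCoins I) (v : V) : ℝ :=
  ∑ u ∈ activeNbrs G c v, ((step G c x).desire u : ℝ)

theorem load_step_le (c : Config V) (x : V → NodeCoins I) (v : V) :
    load G (step G c x) v ≤ nextLoad G c x v := by
  refine Finset.sum_le_sum_of_subset_of_nonneg (fun u hu => ?_) fun u _ _ => NNReal.coe_nonneg _
  rw [mem_activeNbrs] at hu ⊢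
  exact ⟨hu.1, active_of_active_step hu.2⟩

theorem nextLoad_le_two_mul (c : Config V) (x : V → NodeCoins I) (v : V) :
    nextLoad G c x v ≤ 2 * load G c v := by
  rw [nextLoad, load, Finset.mul_sum]
  exact Finset.sum_le_sum fun u hu => desire_step_le_two_mul (mem_activeNbrs.1 hu).2 x

variable (G) in
/-- The light neighbors of `v`: the active ones whose loads are less than `1/2`, so that they are not
guaranteed to recognize their loads as high. -/
def lightNbrs (c : Config V) (v : V) : Finset V :=
  (activeNbrs G c v).filter fun u => load G c u < 1 / 2

variable (G) in
/-- The share of the light neighbors in the load of `v`. -/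
def lightLoad (c : Config V) (v : V) : ℝ := ∑ u ∈ lightNbrs G c v, (c.desire u : ℝ)

/-- The heavy neighbors halve their desire-levels, up to errors of small probability. -/
theorem exists_nextLoad_le (hI : 14000 ≤ I) (c : Config V) (v : V) :
    ∃ e : (V → NodeCoins I) → ℝ, (∀ x, 0 ≤ e x) ∧
      expect (coinsLaw I c) e ≤ 3 / 2000 * load G c v ∧
      ∀ x, nextLoad G c x v ≤ load G c v / 2 + 3 / 2 * lightLoad G c v + e x := by
  set H := (activeNbrs G c v).filter fun u => ¬ load G c u < 1 / 2 with hH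
  have hsum : ∀ f : V → ℝ, ∑ u ∈ lightNbrs G c v, f u + ∑ u ∈ H, f u =
      ∑ u ∈ activeNbrs G c v, f u := fun f => Finset.sum_filter_add_sum_filter_not _ _ _
  have hl0 : 0 ≤ lightLoad G c v := Finset.sum_nonneg fun u _ => NNReal.coe_nonneg _
  have hload : lightLoad G c v + ∑ u ∈ H, (c.desire u : ℝ) = load G c v :=
    hsum fun u => (c.desire u : ℝ)
  refine ⟨fun x => ∑ u ∈ H, 3 / 2 * c.desire u * ind (¬ LikelyHigh G c x u), fun x => ?_, ?_,
    fun x => ?_⟩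
  · exact Finset.sum_nonneg fun u _ => mul_nonneg (by positivity) (ind_nonneg _)
  · rw [expect_sum]
    have : ∀ u ∈ H, expect (coinsLaw I c)
        (fun x => 3 / 2 * c.desire u * ind (¬ LikelyHigh G c x u)) ≤
        3 / 2000 * c.desire u := by
      intro u hu
      rw [hH, Finset.mem_filter, mem_activeNbrs] at hu
      rw [expect_const_mul]
      have := prob_not_likelyHigh_le hI hu.1.2 (not_lt.1 hu.2)
      unfold prob at this
      nlinarith [(c.desire u).coe_nonneg]
    refine (Finset.sum_le_sum this).trans ?_
    rw [← Finset.mul_sum]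
    linarith
  · have h1 : ∑ u ∈ lightNbrs G c v, ((step G c x).desire u : ℝ) ≤ 2 * lightLoad G c v := by
      rw [lightLoad, Finset.mul_sum]
      exact Finset.sum_le_sum fun u hu =>
        desire_step_le_two_mul (mem_activeNbrs.1 (Finset.mem_filter.1 hu).1).2 x
    have h2 : ∑ u ∈ H, ((step G c x).desire u : ℝ) ≤ (∑ u ∈ H, (c.desire u : ℝ)) / 2 +
        ∑ u ∈ H, 3 / 2 * c.desire u * ind (¬ LikelyHigh G c x u) := by
      rw [Finset.sum_div, ← Finset.sum_add_distrib]
      exact Finset.sum_le_sum fun u hu =>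
        desire_step_le (mem_activeNbrs.1 (Finset.mem_filter.1 hu).1).2 x
    rw [nextLoad, ← hsum]
    linarith

end OneRound

/-! ### The potential of a node and its drift -/

section Drift

open scoped Classical

variable {V : Type*} [Fintype V] {G : SimpleGraph V} {I : ℕ} {c : Config V} {v : V}

/-- The potential of a node with load `d` and desire-level `p ≤ 1/2`. It is at least one. A load below
`3/25 = 3/4 * 4/25` counts as `3/25`, so that no progress is lost when a load below `3/50` doubles,
and a load that shrinks by the factor `3/4` from `4/25` is not truncated. The exponent of the load is
six times that of `1 / p`: a decrease of the load by the factor `3/4` outweighs a halving of `p`.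
The exponents are so small that an increase of both factors to the double is outweighed by the
probability, at least `24/10000`, with which a node is removed in a favorable round. -/
def potential (d p : ℝ) : ℝ :=
  (max d (3 / 25) / (3 / 25)) ^ (9 / 5000 : ℝ) * (1 / (2 * p)) ^ (3 / 10000 : ℝ)

theorem potential_nonneg (d : ℝ) {p : ℝ} (hp : 0 ≤ p) : 0 ≤ potential d p := by
  unfold potential
  positivity

theorem potential_mono {d d' p : ℝ} (hp : 0 ≤ p) (h : d ≤ d') : potential d p ≤ potential d' p := by
  unfold potential
  gcongr

theorem one_le_potential (d : ℝ) {p : ℝ} (hp : 0 < p) (hp' : p ≤ 1 / 2) : 1 ≤ potential d p := by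
  refine one_le_mul_of_one_le_of_one_le (Real.one_le_rpow ?_ (by norm_num))
    (Real.one_le_rpow ?_ (by norm_num))
  · rw [one_le_div (by norm_num)]
    exact le_max_right _ _
  · rw [one_le_div (by linarith)]
    linarith

/-- As the exponents are positive and their sum is at most one, the relative change of the
potential is bounded by a linear function of the relative changes of its factors. -/
theorem potential_le_mul (d d' : ℝ) {p p' : ℝ} (hp : 0 < p) (hp' : 0 < p') :
    potential d' p' ≤ potential d p * (1 + 9 / 5000 * (max d' (3 / 25) / max d (3 / 25) - 1) +
      3 / 10000 * (p / p' - 1)) := by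
  have hm : 0 < max d (3 / 25) := lt_max_of_lt_right (by norm_num)
  have hm' : 0 < max d' (3 / 25) := lt_max_of_lt_right (by norm_num)
  have h := Real.geom_mean_le_arith_mean3_weighted (w₁ := 9 / 5000) (w₂ := 3 / 10000)
    (w₃ := 1 - 9 / 5000 - 3 / 10000) (p₁ := max d' (3 / 25) / max d (3 / 25)) (p₂ := p / p')
    (p₃ := 1) (by norm_num) (by norm_num) (by norm_num) (by positivity) (by positivity)
    (by norm_num) (by norm_num)
  rw [Real.one_rpow, mul_one] at h
  have heq : potential d' p' = potential d p *
      ((max d' (3 / 25) / max d (3 / 25)) ^ (9 / 5000 : ℝ) * (p / p') ^ (3 / 10000 : ℝ)) := by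
    unfold potential
    rw [mul_mul_mul_comm, ← Real.mul_rpow (by positivity) (by positivity),
      ← Real.mul_rpow (by positivity) (by positivity)]
    congr 2
    · field_simp
    · field_simp
  rw [heq]
  refine mul_le_mul_of_nonneg_left (h.trans (le_of_eq ?_)) (potential_nonneg d hp.le)
  ring

/-- If the light neighbors of `v` have a small share of its load, then its load is not expected to
increase beyond `3/25`. -/
theorem expect_max_nextLoad_le (hI : 14000 ≤ I)
    (hl : ¬ (3 / 50 ≤ load G c v ∧ load G c v / 6 ≤ lightLoad G c v)) :
    expect (coinsLaw I c) (fun x => max (nextLoad G c x v) (3 / 25)) ≤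
      (1 + 3 / 2000) * max (load G c v) (3 / 25) := by
  have hd0 := load_nonneg (G := G) c v
  obtain ⟨e, he0, he, hle⟩ := exists_nextLoad_le (G := G) hI c v
  have h : ∀ x, max (nextLoad G c x v) (3 / 25) ≤ max (load G c v) (3 / 25) + e x := by
    intro x
    have h1 := le_max_left (load G c v) (3 / 25)
    have h2 := le_max_right (load G c v) (3 / 25)
    refine max_le ?_ (by linarith [he0 x])
    by_cases hd : 3 / 50 ≤ load G c v
    · have : lightLoad G c v < load G c v / 6 := not_le.1 fun h => hl ⟨hd, h⟩
      linarith [hle x]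
    · linarith [nextLoad_le_two_mul (G := G) c x v, he0 x]
  refine (expect_mono _ h).trans ?_
  rw [expect_add, expect_const]
  linarith [le_max_left (load G c v) (3 / 25)]

/-- If the light neighbors of `v` have a small share of its load and the load is not small, then it
is expected to decrease by a constant factor. -/
theorem expect_max_nextLoad_le_of_le (hI : 14000 ≤ I) (hd : 4 / 25 ≤ load G c v)
    (hl : lightLoad G c v < load G c v / 6) :
    expect (coinsLaw I c) (fun x => max (nextLoad G c x v) (3 / 25)) ≤
      (3 / 4 + 3 / 2000) * max (load G c v) (3 / 25) := by
  obtain ⟨e, he0, he, hle⟩ := exists_nextLoad_le (G := G) hI c v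
  have h : ∀ x, max (nextLoad G c x v) (3 / 25) ≤ 3 / 4 * load G c v + e x := fun x =>
    max_le (by linarith [hle x]) (by linarith [he0 x])
  refine (expect_mono _ h).trans ?_
  rw [expect_add, expect_const]
  linarith [le_max_left (load G c v) (3 / 25)]

/-- In each round, the potential of an active node decreases in expectation by a constant factor,
where it counts as zero if the node does not stay active. -/
theorem expect_stays_mul_potential_le (hI : 14000 ≤ I) (hv : c.status v = Status.active)
    (hp : 0 < c.desire v) :
    expect (coinsLaw I c) (fun x => ind (Stays G c x v) *
        potential (nextLoad G c x v) ((step G c x).desire v)) ≤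
      (1 - 1 / 10000) * potential (load G c v) (c.desire v) := by
  have hp0 : (0 : ℝ) < c.desire v := hp
  have hd0 := load_nonneg (G := G) c v
  have hm : 0 < max (load G c v) (3 / 25) := lt_max_of_lt_right (by norm_num)
  set X : (V → NodeCoins I) → ℝ := fun x =>
    max (nextLoad G c x v) (3 / 25) / max (load G c v) (3 / 25) with hX
  set Y : (V → NodeCoins I) → ℝ := fun x => (c.desire v : ℝ) / (step G c x).desire v with hY
  set K : (V → NodeCoins I) → ℝ := fun x =>
    1 + 9 / 5000 * (X x - 1) + 3 / 10000 * (Y x - 1) with hK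
  have hX0 : ∀ x, 0 ≤ X x := fun x => div_nonneg (le_max_of_le_right (by norm_num)) hm.le
  have hX2 : ∀ x, X x ≤ 2 := fun x => by
    rw [hX, div_le_iff₀ hm]
    refine max_le ((nextLoad_le_two_mul c x v).trans ?_) ?_
    · linarith [le_max_left (load G c v) (3 / 25)]
    · linarith [le_max_right (load G c v) (3 / 25)]
  have hY0 : ∀ x, 0 ≤ Y x := fun x => by positivity
  have hY2 : ∀ x, Y x ≤ 2 := desire_div_desire_step_le_two hv hp
  have hEX : expect (coinsLaw I c) X =
      expect (coinsLaw I c) (fun x => max (nextLoad G c x v) (3 / 25)) /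
        max (load G c v) (3 / 25) := by
    simp only [hX, expect, Finset.sum_div, mul_div_assoc]
  have hEK : expect (coinsLaw I c) K = 1 - 9 / 5000 - 3 / 10000 +
      9 / 5000 * expect (coinsLaw I c) X + 3 / 10000 * expect (coinsLaw I c) Y := by
    rw [← expect_const_mul, ← expect_const_mul,
      ← expect_const (coinsLaw I c) (1 - 9 / 5000 - 3 / 10000 : ℝ), ← expect_add, ← expect_add]
    congr 1
    funext x
    simp only [hK]
    ring
  have hEK' : expect (coinsLaw I c) (fun x => ind (Stays G c x v) * K x) ≤
      expect (coinsLaw I c) K := expect_mono _ fun x =>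
    mul_le_of_le_one_left (by simp only [hK]; linarith [hX0 x, hY0 x]) (ind_le_one _)
  -- A favorable round: the node is removed with sufficient probability. Both factors of the
  -- potential may then double.
  have hgold : prob (coinsLaw I c) (fun x => Stays G c x v) ≤ 1 - 24 / 10000 →
      expect (coinsLaw I c) (fun x => ind (Stays G c x v) * K x) ≤ 1 - 1 / 10000 := by
    intro h
    have : expect (coinsLaw I c) (fun x => ind (Stays G c x v) * K x) ≤
        expect (coinsLaw I c) fun x => (1 + 21 / 10000) * ind (Stays G c x v) := by
      refine expect_mono _ fun x => ?_
      rw [mul_comm]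
      refine mul_le_mul_of_nonneg_right ?_ (ind_nonneg _)
      simp only [hK]
      linarith [hX2 x, hY2 x]
    rw [expect_const_mul] at this
    unfold prob at h
    linarith
  have key : expect (coinsLaw I c) (fun x => ind (Stays G c x v) * K x) ≤ 1 - 1 / 10000 := by
    by_cases hl : 3 / 50 ≤ load G c v ∧ load G c v / 6 ≤ lightLoad G c v
    · refine hgold ((prob_stays_le_of_light (L := lightNbrs G c v) (Finset.filter_subset _ _)
        (fun u hu => (Finset.mem_filter.1 hu).2.le) rfl).trans ?_)
      have h1 : 1 / 100 ≤ lightLoad G c v := by linarith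
      have h2 : 24 / 10000 ≤ lightLoad G c v / (4 * (1 + lightLoad G c v)) := by
        rw [le_div_iff₀ (by linarith)]
        linarith
      exact sub_le_sub_left h2 1
    -- Otherwise the heavy neighbors dominate. If the load is small, then either `p` is likely to
    -- double, or `p` is large and `v` itself is likely to join. If it is not, it is likely to shrink.
    by_cases hd : load G c v ≤ 4 / 25
    · by_cases hp4 : (c.desire v : ℝ) ≤ 1 / 4
      · have h1 : expect (coinsLaw I c) X ≤ 1 + 3 / 2000 := by
          rw [hEX, div_le_iff₀ hm]
          exact expect_max_nextLoad_le hI hl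
        have h2 := expect_desire_div_le hI hv hp hp4 hd
        change expect (coinsLaw I c) Y ≤ _ at h2
        linarith
      · refine hgold ((prob_stays_le_of_self hv).trans ?_)
        nlinarith
    · have h1 : expect (coinsLaw I c) X ≤ 3 / 4 + 3 / 2000 := by
        rw [hEX, div_le_iff₀ hm]
        exact expect_max_nextLoad_le_of_le hI (by linarith)
          (not_le.1 fun h => hl ⟨by linarith, h⟩)
      have h2 : expect (coinsLaw I c) Y ≤ 2 :=
        (expect_mono _ hY2).trans (le_of_eq (expect_const _ _))
      linarith
  have hle : ∀ x, ind (Stays G c x v) * potential (nextLoad G c x v) ((step G c x).desire v) ≤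
      potential (load G c v) (c.desire v) * (ind (Stays G c x v) * K x) := by
    intro x
    rw [mul_left_comm]
    refine mul_le_mul_of_nonneg_left ?_ (ind_nonneg _)
    exact potential_le_mul _ _ hp0 (by linarith [half_le_desire_step (G := G) hv x])
  refine (expect_mono _ hle).trans ?_
  rw [expect_const_mul, mul_comm (1 - 1 / 10000 : ℝ)]
  exact mul_le_mul_of_nonneg_left key (potential_nonneg _ hp0.le)

/-- The quantity `(8 + 3 p) / C`, where `C` is the number of choices of slots, bounds the
probability that `v` ever has a conflict: it pays for the conflicts of each round. If the load of
`v` is below `1/2`, then `v` is removed with probability at least `p / 2`, and otherwise `p` is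
likely to be halved. -/
theorem expect_conflict_add_le (hI : 14000 ≤ I) (hv : c.status v = Status.active) :
    expect (coinsLaw I c) (fun x => ind (Conflict G c x v) +
        ind (Stays G c x v) * ((8 + 3 * (step G c x).desire v) / (I.choose (I / 2) : ℝ))) ≤
      (8 + 3 * c.desire v) / (I.choose (I / 2) : ℝ) := by
  have hp0 : (0 : ℝ) ≤ c.desire v := NNReal.coe_nonneg _
  set C : ℝ := (I.choose (I / 2) : ℝ) with hC
  have hC0 : 0 < C := by
    rw [hC]
    exact_mod_cast Nat.choose_pos (Nat.div_le_self I 2)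
  have h1 := prob_conflict_le (I := I) (G := G) c v
  have h2 : expect (coinsLaw I c)
      (fun x => ind (Stays G c x v) * (8 + 3 * ((step G c x).desire v : ℝ))) ≤
      8 + 2 * c.desire v := by
    by_cases hd : load G c v ≤ 1 / 2
    · have : ∀ x : V → NodeCoins I, ind (Stays G c x v) * (8 + 3 * ((step G c x).desire v : ℝ)) ≤
          8 * ind (Stays G c x v) + 6 * c.desire v := fun x => by
        nlinarith [mul_le_of_le_one_left (NNReal.coe_nonneg ((step G c x).desire v))
          (ind_le_one (Stays G c x v)), desire_step_le_two_mul (G := G) hv x]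
      refine (expect_mono _ this).trans ?_
      rw [expect_add, expect_const_mul, expect_const]
      have h := prob_stays_le_of_self (I := I) (G := G) hv
      unfold prob at h
      nlinarith
    · have : ∀ x : V → NodeCoins I, ind (Stays G c x v) * (8 + 3 * ((step G c x).desire v : ℝ)) ≤
          8 + 3 * (step G c x).desire v := fun x =>
        mul_le_of_le_one_left (by positivity) (ind_le_one _)
      refine (expect_mono _ this).trans ?_
      rw [expect_add, expect_const_mul, expect_const]
      linarith [expect_desire_step_le hI hv (not_le.1 hd).le]
  rw [expect_add]
  have h3 : expect (coinsLaw I c) (fun x => ind (Stays G c x v) *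
      ((8 + 3 * ((step G c x).desire v : ℝ)) / C)) ≤ (8 + 2 * c.desire v) / C := by
    rw [div_eq_inv_mul]
    refine le_trans (le_of_eq ?_) (mul_le_mul_of_nonneg_left h2 (inv_nonneg.2 hC0.le))
    rw [← expect_const_mul]
    congr 1
    funext x
    ring
  unfold prob at h1
  refine (add_le_add h1 h3).trans (le_of_eq ?_)
  ring

end Drift

/-! ### Executions and neighborhoods -/

section Executions

variable {V : Type*} {G : SimpleGraph V} {I : ℕ} {v : V}

theorem mem_twoHop_self (G : SimpleGraph V) (v : V) : v ∈ twoHop G v := by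
  simp [twoHop]

theorem mem_twoHop_of_adj {u : V} (h : G.Adj v u) : u ∈ twoHop G v := by
  have : G.edist u v = 1 := SimpleGraph.edist_eq_one_iff_adj.2 h.symm
  change G.edist u v ≤ 2
  rw [this]
  norm_num

theorem mem_twoHop_of_adj_of_adj {u w : V} (h : G.Adj v u) (h' : G.Adj u w) :
    w ∈ twoHop G v := by
  have h1 : G.edist u v = 1 := SimpleGraph.edist_eq_one_iff_adj.2 h.symm
  have h2 : G.edist w u = 1 := SimpleGraph.edist_eq_one_iff_adj.2 h'.symm
  refine (SimpleGraph.edist_triangle (v := u)).trans ?_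
  rw [h1, h2]
  norm_num

theorem desire_pos (h : List (V → NodeCoins I)) (v : V) : 0 < (config G h).desire v := by
  induction h with
  | nil => simp [config, initial]
  | cons x h ih =>
    simp only [config, step]
    split_ifs
    · exact half_pos ih
    · exact lt_min (by positivity) (by norm_num)
    · exact ih

theorem tsum_execution_succ (round : List (V → NodeCoins I) → PMF (V → NodeCoins I)) (T : ℕ)
    (g : List (V → NodeCoins I) → ℝ≥0∞) :
    ∑' h, execution round (T + 1) h * g h =
      ∑' h, execution round T h * ∑' x, round h x * g (x :: h) := by
  rw [execution, tsum_bind_mul]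
  simp only [PMF.map, tsum_bind_mul, Function.comp_apply, tsum_pure_mul]

theorem length_of_execution_ne_zero (round : List (V → NodeCoins I) → PMF (V → NodeCoins I))
    (T : ℕ) (h : List (V → NodeCoins I)) (hh : execution round T h ≠ 0) : h.length = T := by
  induction T generalizing h with
  | zero =>
    by_contra hl
    have : h ≠ [] := fun h0 => hl (by simp [h0])
    exact hh (by simp [execution, PMF.pure_apply, this])
  | succ T ih =>
    rw [← PMF.mem_support_iff, execution, PMF.mem_support_bind_iff] at hh
    obtain ⟨h', hh', hx⟩ := hh
    rw [PMF.support_map] at hx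
    obtain ⟨x, -, rfl⟩ := hx
    simp [ih h' hh']

end Executions

/-! ### Rounds with an adversary -/

section Locality

open scoped Classical

variable {V : Type*} [Fintype V] {G : SimpleGraph V} {I : ℕ} {c : Config V} {v : V}

/-- Whether `v` decides in a round, and what its desire-level and the desire-levels of its
neighbors are, depends only on the coin tosses of the nodes of `N₂⁺(v)`. -/
theorem dependsOn_twoHop {x y : V → NodeCoins I} (h : ∀ u ∈ twoHop G v, x u = y u) :
    (Conflict G c x v ↔ Conflict G c y v) ∧ (Stays G c x v ↔ Stays G c y v) ∧
      (step G c x).desire v = (step G c y).desire v ∧ nextLoad G c x v = nextLoad G c y v := by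
  have hv := h v (mem_twoHop_self G v)
  have hu : ∀ u, G.Adj v u → x u = y u := fun u hu => h u (mem_twoHop_of_adj hu)
  have hw : ∀ u, G.Adj v u → ∀ w, G.Adj u w → x w = y w := fun u hu w hw =>
    h w (mem_twoHop_of_adj_of_adj hu hw)
  have hjv := mem_joining_congr (G := G) (c := c) hv hu
  have hju := fun u (huv : G.Adj v u) =>
    mem_joining_congr (G := G) (c := c) (hu u huv) (hw u huv)
  have hlv := likelyHigh_congr (G := G) (c := c) hv hu
  have hlu := fun u (huv : G.Adj v u) =>
    likelyHigh_congr (G := G) (c := c) (hu u huv) (hw u huv)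
  refine ⟨and_congr hjv (exists_congr fun u => and_congr_right fun huv => hju u huv),
    and_congr (not_congr hjv) (forall_congr' fun u => forall_congr' fun huv => not_congr (hju u huv)),
    by simp only [step, hlv], Finset.sum_congr rfl fun u hu' => ?_⟩
  simp only [step, hlu u (mem_activeNbrs.1 hu').1]

/-- After each history, the coin tosses of the nodes of `S` have the joint law that the algorithm
prescribes. Nothing is required of the coin tosses of the other nodes, which may depend on them. -/
def FairOn (G : SimpleGraph V) (S : Set V)
    (round : List (V → NodeCoins I) → PMF (V → NodeCoins I)) : Prop :=
  ∀ h, ∀ f : (V → NodeCoins I) → ℝ, DependsOn f S →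
    expect (round h) f = expect (coinsLaw I (config G h)) f

theorem fairOn_fairRound (G : SimpleGraph V) (S : Set V) : FairOn (I := I) G S (fairRound G) :=
  fun _ _ _ => rfl

theorem fairOn_adversarialRound (G : SimpleGraph V) {S : Set V} (adv : Adversary S I) :
    FairOn G S (adversarialRound G adv) := fun h f hf => by
  rw [adversarialRound, expect_map, coinsLaw, expect_indepLaw_of_dependsOn _ S hf (adv h)]
  rfl

/-! ### The failure probability of an execution -/

variable (G I) in
/-- A bound for the probability that `v` is not settled after `k` more rounds. The first summand
accounts for remaining active, the second one for conflicts. -/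
def failureBound (v : V) (k : ℕ) (c : Config V) : ℝ :=
  if c.status v = Status.active then
    (1 - 1 / 10000) ^ k * potential (load G c v) (c.desire v) +
      (8 + 3 * c.desire v) / (I.choose (I / 2) : ℝ)
  else ind (¬ Settled G c v)

theorem failureBound_nonneg (v : V) (k : ℕ) (c : Config V) : 0 ≤ failureBound G I v k c := by
  unfold failureBound
  split_ifs
  · have := potential_nonneg (load G c v) (c.desire v).coe_nonneg
    norm_num
    positivity
  · exact ind_nonneg _

theorem ind_not_settled_le_failureBound (h : List (V → NodeCoins I)) (v : V) :
    ind (¬ Settled G (config G h) v) ≤ failureBound G I v 0 (config G h) := by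
  unfold failureBound
  split_ifs
  · have h1 := one_le_potential (load G (config G h) v) (p := (config G h).desire v)
      (desire_pos h v) (coe_desire_le _ _)
    have h2 : (0 : ℝ) ≤ (8 + 3 * (config G h).desire v) / (I.choose (I / 2) : ℝ) := by positivity
    rw [pow_zero, one_mul]
    linarith [ind_le_one (¬ Settled G (config G h) v)]
  · exact le_rfl

theorem expect_failureBound_le (hI : 14000 ≤ I)
    {round : List (V → NodeCoins I) → PMF (V → NodeCoins I)} (hround : FairOn G (twoHop G v) round)
    (k : ℕ) (h : List (V → NodeCoins I)) :
    expect (round h) (fun x => failureBound G I v k (config G (x :: h))) ≤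
      failureBound G I v (k + 1) (config G h) := by
  by_cases hv : (config G h).status v = Status.active
  -- The bound after the round is replaced by the larger `F`, which is not affected by the coin
  -- tosses outside `N₂⁺(v)`.
  · set c := config G h with hc
    set F : (V → NodeCoins I) → ℝ := fun x =>
      (1 - 1 / 10000) ^ k * (ind (Stays G c x v) *
        potential (nextLoad G c x v) ((step G c x).desire v)) +
      (ind (Conflict G c x v) + ind (Stays G c x v) *
        ((8 + 3 * (step G c x).desire v) / (I.choose (I / 2) : ℝ))) with hF
    have hFdep : DependsOn F (twoHop G v) := fun x y hxy => by
      obtain ⟨h1, h2, h3, h4⟩ := dependsOn_twoHop (c := c) hxy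
      simp only [hF, h1, h2, h3, h4]
    have hpot : ∀ x : V → NodeCoins I, 0 ≤ (1 - 1 / 10000 : ℝ) ^ k * (ind (Stays G c x v) *
        potential (nextLoad G c x v) ((step G c x).desire v)) := fun x =>
      mul_nonneg (by norm_num)
        (mul_nonneg (ind_nonneg _) (potential_nonneg _ (NNReal.coe_nonneg _)))
    have hcon : ∀ x : V → NodeCoins I, 0 ≤ ind (Stays G c x v) *
        ((8 + 3 * ((step G c x).desire v : ℝ)) / (I.choose (I / 2) : ℝ)) := fun x =>
      mul_nonneg (ind_nonneg _) (by positivity)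
    have hle : ∀ x, failureBound G I v k (config G (x :: h)) ≤ F x := by
      intro x
      rw [config, ← hc, failureBound]
      by_cases hs : Stays G c x v
      · rw [if_pos (status_step_of_forall_notMem hv hs.1 hs.2)]
        simp only [hF, ind_of hs, one_mul]
        have h1 := potential_mono (NNReal.coe_nonneg ((step G c x).desire v))
          (load_step_le (G := G) c x v)
        have h2 := mul_le_mul_of_nonneg_left h1 (by norm_num : (0 : ℝ) ≤ (1 - 1 / 10000) ^ k)
        linarith [ind_nonneg (Conflict G c x v)]
      · have hna : (step G c x).status v ≠ Status.active := fun ha =>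
          hs ⟨notMem_joining_of_active_step ha, fun u huv hu => by
            have := status_step_of_adj_joining hv (notMem_joining_of_active_step ha) huv hu
            simp [this] at ha⟩
        rw [if_neg hna]
        by_cases hcf : Conflict G c x v
        · have h1 := hpot x
          have h2 := hcon x
          simp only [hF, ind_of hcf]
          linarith [ind_le_one (¬ Settled G (step G c x) v)]
        · rw [ind_of_not (not_not.2 (settled_step hv hcf hs))]
          have h1 := hpot x
          have h2 := hcon x
          simp only [hF]
          linarith [ind_nonneg (Conflict G c x v)]
    refine (expect_mono _ hle).trans ?_
    rw [hround h F hFdep, ← hc, hF, expect_add, expect_const_mul, failureBound, if_pos hv, pow_succ]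
    have h1 := expect_stays_mul_potential_le (G := G) hI hv (desire_pos h v)
    have h2 := mul_le_mul_of_nonneg_left h1 (by norm_num : (0 : ℝ) ≤ (1 - 1 / 10000) ^ k)
    have h3 := expect_conflict_add_le (G := G) hI hv
    rw [mul_assoc]
    exact add_le_add h2 h3
  · rw [failureBound, if_neg hv, ← expect_const (round h) (ind (¬ Settled G (config G h) v))]
    refine expect_mono _ fun x => ?_
    have hna : (config G (x :: h)).status v ≠ Status.active := by
      rw [config, status_step_of_ne_active x hv]
      exact hv
    rw [failureBound, if_neg hna]
    refine ind_le_of_imp (ind_nonneg _) fun hx => ?_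
    rw [ind_of fun hs : Settled G (config G h) v => hx (hs.step x)]

theorem tsum_execution_failureBound_le (hI : 14000 ≤ I)
    {round : List (V → NodeCoins I) → PMF (V → NodeCoins I)} (hround : FairOn G (twoHop G v) round)
    (k T : ℕ) :
    ∑' h, execution round T h * ENNReal.ofReal (failureBound G I v k (config G h)) ≤
      ENNReal.ofReal (failureBound G I v (k + T) (initial V)) := by
  induction T generalizing k with
  | zero =>
    rw [tsum_eq_single [] fun h hh => by simp [execution, PMF.pure_apply, hh]]
    simp [execution, config]
  | succ T ih =>
    rw [tsum_execution_succ]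
    refine le_trans (ENNReal.tsum_le_tsum fun h => ?_) ((ih (k + 1)).trans_eq (by
      rw [add_right_comm, add_assoc]))
    gcongr
    rw [tsum_mul_ofReal _ fun x => failureBound_nonneg v k _]
    exact ENNReal.ofReal_le_ofReal (expect_failureBound_le hI hround k h)

/-- Once the first `R` rounds have settled `v`, the later rounds cannot change its decision. -/
theorem le_prob_decidesCorrectly (hI : 14000 ≤ I)
    {round : List (V → NodeCoins I) → PMF (V → NodeCoins I)} (hround : FairOn G (twoHop G v) round)
    {R T : ℕ} (hRT : R ≤ T) {ε : ℝ} (hε : failureBound G I v R (initial V) ≤ ε) :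
    ENNReal.ofReal (1 - ε) ≤
      (execution round T).toOuterMeasure {h | DecidesCorrectly G R v h} := by
  obtain ⟨s, rfl⟩ := Nat.exists_eq_add_of_le hRT
  have hdrop : ∑' h, execution round (R + s) h *
      ENNReal.ofReal (failureBound G I v 0 (config G (h.drop s))) ≤ ENNReal.ofReal ε := by
    have h0 := (tsum_execution_failureBound_le hI hround 0 R).trans
      (ENNReal.ofReal_le_ofReal ((zero_add R).symm ▸ hε))
    clear hRT
    induction s with
    | zero => simpa using h0
    | succ s ih =>
      rw [← add_assoc, tsum_execution_succ]
      refine le_trans (le_of_eq (tsum_congr fun h => ?_)) ih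
      simp only [List.drop_succ_cons]
      rw [ENNReal.tsum_mul_right, PMF.tsum_coe, one_mul]
  have hone : 1 ≤ (execution round (R + s)).toOuterMeasure {h | DecidesCorrectly G R v h} +
      ENNReal.ofReal ε := by
    refine le_trans ?_ (add_le_add_right hdrop _)
    rw [PMF.toOuterMeasure_apply, ← ENNReal.tsum_add, ← (execution round (R + s)).tsum_coe]
    refine ENNReal.tsum_le_tsum fun h => ?_
    by_cases hh : execution round (R + s) h = 0
    · simp [hh]
    have hlen := length_of_execution_ne_zero round (R + s) h hh
    by_cases hd : DecidesCorrectly G R v h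
    · rw [Set.indicator_of_mem (show h ∈ {h | DecidesCorrectly G R v h} from hd)]
      exact le_self_add
    · have hns : ¬ Settled G (config G (h.drop s)) v := fun hs =>
        hd (decidesCorrectly_of_settled (by omega) (by
          rwa [configAt, show h.length - R = s by omega]))
      have h1 := ind_not_settled_le_failureBound (G := G) (h.drop s) v
      rw [ind_of hns] at h1
      refine le_trans ?_ le_add_self
      calc execution round (R + s) h = execution round (R + s) h * 1 := (mul_one _).symm
        _ ≤ _ := by
          gcongr
          exact ENNReal.one_le_ofReal.2 h1
  rw [ENNReal.ofReal_sub _ ((failureBound_nonneg _ _ _).trans hε), ENNReal.ofReal_one]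
  exact tsub_le_iff_right.2 hone

end Locality

/-! ### The parameters of the algorithm -/

theorem log_three_thousand_div {ε : ℝ} (hε : 0 < ε) :
    Real.log 1500 + Real.log (2 / ε) = Real.log (3000 / ε) := by
  rw [← Real.log_mul (by norm_num) (by positivity)]
  congr 1
  ring

theorem le_intervalLength {ε : ℝ} (hε0 : 0 < ε) (hε1 : ε ≤ 1) : 14000 ≤ intervalLength ε := by
  have h7 : 7 ≤ Real.log 1500 + Real.log (2 / ε) := by
    rw [log_three_thousand_div hε0, Real.le_log_iff_exp_le (by positivity)]
    have h1 : Real.exp 7 = Real.exp 1 ^ 7 := by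
      rw [← Real.exp_nat_mul]
      norm_num
    have h2 : Real.exp 1 ^ 7 ≤ 2.72 ^ 7 := by
      gcongr
      linarith [Real.exp_one_lt_d9]
    have h3 : (3000 : ℝ) ≤ 3000 / ε := by
      rw [le_div_iff₀ hε0]
      nlinarith
    rw [h1]
    exact h2.trans (le_trans (by norm_num) h3)
  have h : (7000 : ℝ) ≤ ⌈1000 * (Real.log 1500 + Real.log (2 / ε))⌉₊ :=
    le_trans (by linarith) (Nat.le_ceil _)
  have h' : 7000 ≤ ⌈1000 * (Real.log 1500 + Real.log (2 / ε))⌉₊ := by exact_mod_cast h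
  unfold intervalLength
  omega

theorem le_choose_intervalLength {ε : ℝ} (hε0 : 0 < ε) (hε1 : ε ≤ 1) :
    3000 / ε ≤ ((intervalLength ε).choose (intervalLength ε / 2) : ℝ) := by
  have hI := le_intervalLength hε0 hε1
  unfold intervalLength at hI ⊢
  set n := ⌈1000 * (Real.log 1500 + Real.log (2 / ε))⌉₊ with hn
  have hn1 : 1000 * Real.log (3000 / ε) ≤ n := by
    rw [← log_three_thousand_div hε0]
    exact Nat.le_ceil _
  have hlog : 0 ≤ Real.log (3000 / ε) := Real.log_nonneg (by
    rw [le_div_iff₀ hε0]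
    linarith)
  have h2 : (2 : ℝ) ^ n ≤ ((2 * n).choose n : ℝ) := by
    have h4 := Nat.four_pow_lt_mul_centralBinom n (by omega)
    have hlt : n < 2 ^ n := Nat.lt_two_pow_self
    have : 2 ^ n * 2 ^ n ≤ 2 ^ n * n.centralBinom := by
      rw [← mul_pow]
      exact h4.le.trans (Nat.mul_le_mul_right _ hlt.le)
    have := Nat.le_of_mul_le_mul_left this (by positivity)
    exact_mod_cast this
  rw [Nat.mul_div_cancel_left n (by norm_num)]
  refine le_trans ?_ h2
  calc 3000 / ε = Real.exp (Real.log (3000 / ε)) := (Real.exp_log (by positivity)).symm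
    _ ≤ Real.exp (n * Real.log 2) := Real.exp_le_exp.2 (by
        nlinarith [Real.log_two_gt_d9])
    _ = 2 ^ n := by rw [Real.exp_nat_mul, Real.exp_log (by norm_num)]

theorem potential_initial_mul_le {D : ℕ} {ε d : ℝ} (hε0 : 0 < ε) (hε1 : ε ≤ 1)
    (hd : d ≤ D / 2) :
    (1 - 1 / 10000) ^ rounds D ε * potential d (1 / 2) ≤ ε / 2 := by
  have hlogD : 0 ≤ Real.log D := Real.log_natCast_nonneg D
  have hlogε : 0 ≤ Real.log (2 / ε) := Real.log_nonneg (by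
    rw [le_div_iff₀ hε0]
    linarith)
  have hR : 104000 * (Real.log D + Real.log (2 / ε)) - 1 ≤ rounds D ε := by
    linarith [Nat.lt_floor_add_one (104000 * (Real.log D + Real.log (2 / ε))),
      show (rounds D ε : ℝ) = ⌊104000 * (Real.log D + Real.log (2 / ε))⌋₊ from rfl]
  have hpot : potential d (1 / 2) ≤ 5 * Real.exp (Real.log D) := by
    have hD : max d (3 / 25) / (3 / 25) ≤ 5 * Real.exp (Real.log D) := by
      rw [div_le_iff₀ (by norm_num)]
      have h1 : 1 ≤ Real.exp (Real.log D) := Real.one_le_exp hlogD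
      have h2 : (D : ℝ) ≤ Real.exp (Real.log D) := Real.le_exp_log _
      exact max_le (by linarith) (by linarith)
    have h1 : 1 ≤ max d (3 / 25) / (3 / 25) := by
      rw [one_le_div (by norm_num)]
      exact le_max_right _ _
    unfold potential
    rw [mul_one_div_cancel two_ne_zero, div_one, Real.one_rpow, mul_one]
    exact (Real.rpow_le_rpow_of_exponent_le h1 (by norm_num : (9 / 5000 : ℝ) ≤ 1)).trans
      (by rwa [Real.rpow_one])
  have hpow : (1 - 1 / 10000 : ℝ) ^ rounds D ε ≤
      Real.exp (1 - Real.log D - 6 * Real.log (2 / ε)) := by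
    calc (1 - 1 / 10000 : ℝ) ^ rounds D ε ≤ Real.exp (-(1 / 10000)) ^ rounds D ε := by
          exact pow_le_pow_left₀ (by norm_num) (Real.one_sub_le_exp_neg _) _
      _ = Real.exp (rounds D ε * -(1 / 10000)) := (Real.exp_nat_mul _ _).symm
      _ ≤ _ := Real.exp_le_exp.2 (by linarith)
  have h6 : Real.exp (-(6 * Real.log (2 / ε))) = (ε / 2) ^ 6 := by
    rw [Real.exp_neg, show (6 : ℝ) = (6 : ℕ) by norm_num, Real.exp_nat_mul,
      Real.exp_log (by positivity), ← inv_pow, inv_div]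
  calc (1 - 1 / 10000) ^ rounds D ε * potential d (1 / 2)
      ≤ Real.exp (1 - Real.log D - 6 * Real.log (2 / ε)) * (5 * Real.exp (Real.log D)) := by
        gcongr
        exact potential_nonneg _ (by norm_num)
    _ = 5 * Real.exp 1 * (ε / 2) ^ 6 := by
        rw [← h6, mul_left_comm, ← Real.exp_add, mul_assoc, ← Real.exp_add]
        congr 2
        ring
    _ ≤ 16 * (ε / 2) ^ 6 := by
        gcongr
        linarith [Real.exp_one_lt_d9]
    _ = 16 * (ε / 2) ^ 5 * (ε / 2) := by ring
    _ ≤ 16 * (1 / 2) ^ 5 * (ε / 2) := by gcongr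
    _ ≤ ε / 2 := by linarith

theorem failureBound_initial_le {V : Type*} [Fintype V] (G : SimpleGraph V) [DecidableRel G.Adj]
    (v : V) {ε : ℝ} (hε0 : 0 < ε) (hε1 : ε ≤ 1) :
    failureBound G (intervalLength ε) v (rounds G.maxDegree ε) (initial V) ≤ ε := by
  have hload : load G (initial V) v ≤ G.maxDegree / 2 := by
    have hcard : (activeNbrs G (initial V) v).card = G.degree v := by
      rw [← G.card_neighborFinset_eq_degree]
      congr 1
      ext u
      simp [mem_activeNbrs, initial]
    have hdeg : (G.degree v : ℝ) ≤ G.maxDegree := by exact_mod_cast G.degree_le_maxDegree v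
    simp only [load, initial, Finset.sum_const, nsmul_eq_mul]
    change ((activeNbrs G (initial V) v).card : ℝ) * _ ≤ _
    rw [hcard]
    push_cast
    linarith
  have h1 := potential_initial_mul_le hε0 hε1 hload
  have h2 : (8 + 3 * (1 / 2 : ℝ)) /
      ((intervalLength ε).choose (intervalLength ε / 2) : ℝ) ≤ ε / 2 := by
    have h := le_choose_intervalLength hε0 hε1
    have hpos : 0 < 3000 / ε := by positivity
    rw [div_le_iff₀ (hpos.trans_le h)]
    have := mul_le_mul_of_nonneg_left h hε0.le
    rw [mul_div_cancel₀ _ hε0.ne'] at this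
    linarith
  have hp : (((initial V).desire v : ℝ≥0) : ℝ) = 1 / 2 := by simp [initial]
  rw [failureBound, if_pos (show (initial V).status v = Status.active from rfl), hp]
  linarith

end BeepMIS

end

/-- With probability at least `1 - ε`, the node `v` makes a locally correct decision within the
first `R` emulated rounds, however long (`T` rounds) the execution is observed: if all nodes toss
their coins, and even if the outcomes of the coin tosses outside `N₂⁺(v)` are determined by an
adversary. -/
theorem theorem3 {V : Type*} [Fintype V] (G : SimpleGraph V) [DecidableRel G.Adj] (v : V)
    (ε : ℝ) (hε0 : 0 < ε) (hε1 : ε ≤ 1) (T : ℕ) (hT : BeepMIS.rounds G.maxDegree ε ≤ T) :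
    ENNReal.ofReal (1 - ε) ≤
        (BeepMIS.execution (BeepMIS.fairRound (I := BeepMIS.intervalLength ε) G) T).toOuterMeasure
          {h | BeepMIS.DecidesCorrectly G (BeepMIS.rounds G.maxDegree ε) v h} ∧
      ∀ adv : BeepMIS.Adversary (BeepMIS.twoHop G v) (BeepMIS.intervalLength ε),
        ENNReal.ofReal (1 - ε) ≤
          (BeepMIS.execution (BeepMIS.adversarialRound G adv) T).toOuterMeasure
            {h | BeepMIS.DecidesCorrectly G (BeepMIS.rounds G.maxDegree ε) v h} := by
  have hI := BeepMIS.le_intervalLength hε0 hε1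
  have hb := BeepMIS.failureBound_initial_le G v hε0 hε1
  exact ⟨BeepMIS.le_prob_decidesCorrectly hI (BeepMIS.fairOn_fairRound G _) hT hb,
    fun adv => BeepMIS.le_prob_decidesCorrectly hI (BeepMIS.fairOn_adversarialRound G adv) hT hb⟩
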